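/- \textbf{Setting.} Let $G$ be a finite undirected multigraph on $n\ge 1$ vertices (parallel edges and self-loops allowed). A matching is a set $M$ of non-loop edges no two of which share an endpoint. For $\lambda>0$ put $Z(G,\lambda)=\sum_M\lambda^{|M|}$, $\pi_{G,\lambda}(M)=\lambda^{|M|}/Z(G,\lambda)$ and $E(G,\lambda)=\sum_M |M|\,\pi_{G,\lambda}(M)$, the sums being over all matchings of $G$. An algorithm knows the vertex set and accesses $G$ only through two oracles: $\mathcal D(v)$ returns the degree of $v$, and $\mathcal N(v,i)$ returns the other endpoint of the $i$-th entry in the list of edges at $v$ (a non-loop edge is listed once at each endpoint; a self-loop once or twice at its vertex; the degree is the length of the list). The number of queries is the total number of accesses to the oracles. For $p\in(1/2,1)$, a randomized algorithm is an $\epsilon n$-approximation algorithm for $E(G,\lambda)$ with success probability $p$ on a class of graphs if, for every $G$ in the class, it outputs with probability at least $p$ a number $\widehat E$ with $|\widehat E-E(G,\lambda)|\le\epsilon n$. \textbf{The algorithm.} For a vertex $s$ and a simple path $P$ with $\ell-1$ vertices, ending next to $s$ and not containing it ($P$ is empty if $\ell=1$), $\mathrm{DFS}(\lambda,h,s,\ell)$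 returns $1$ if $\ell=h$; otherwise it queries $\mathcal D(s)$ and $t_i=\mathcal N(s,i)$ for $1\le i\le\mathcal D(s)$, and returns $1/(1+\lambda\sum_i \mathrm{DFS}(\lambda,h,t_i,\ell+1))$, where the sum is over the $i$ for which $t_i$ is neither $s$ nor on $P$, and $P$ is extended by $s$ in the recursive calls. $\textsc{Approx-Marginal}(\lambda,\epsilon,v)$ computes $x[h]=\mathrm{DFS}(\lambda,h,v,1)$ for $h=1,2,3,\dots$ and returns $x[h]$ for the first $h\ge2$ with $|\log x[h]-\log x[h-1]|\le\epsilon/e$. With a constant $C>0$, $\textsc{Approx-Matching-Statistics}(\lambda,\epsilon)$ samples a multiset $U$ of $s=\lceil C/\epsilon^2\rceil$ vertices independently and uniformly at random and returns $$\frac n2-\frac{n}{2s}\sum_{u\in U}\textsc{Approx-Marginal}(\lambda,\epsilon/2,u).$$ \textbf{Theorem.} Let $p\in(1/2,1)$. (1) There is a constant $C=C(p)>0$ such that for every $\lambda>0$ the following hold. For all $n\ge1$ and $\epsilon>0$, $\textsc{Approx-Matching-Statistics}(\lambda,\epsilon)$ is an $\epsilon n$-approximation algorithm for $E(G,\lambda)$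 with success probability $p$ on all graphs with $n$ vertices. Its query complexity is $\tilde O\big((1/\epsilon)^{\tilde O(\sqrt\Delta)}\big)$, independently of $n$: there are $K>0$ and $a\in\mathbb N$, depending only on $\lambda$ and $p$, such that for all $\Delta\ge2$, $0<\epsilon\le1/2$, $n\ge1$, and all graphs $G$ with $n$ vertices and maximum degree at most $\Delta$, it makes, whatever vertices are sampled, at most $$K\,(1/\epsilon)^{K\sqrt{\Delta}\,(\log\Delta)^a}$$ queries. (2) Any $\epsilon n$-approximation algorithm for $E(G,\lambda)$ needs $\Omega(1/\epsilon^2)$ queries on average: for every $\lambda>0$ there are $c,C',\epsilon_0>0$, depending only on $\lambda$ and $p$, such that for all $\Delta\ge1$, $n\ge1$ and $\epsilon$ with $C'/\sqrt n<\epsilon\le\epsilon_0$, and for every randomized algorithm which is an $\epsilon n$-approximation algorithm for $E(G,\lambda)$ with success probability $p$ on the graphs with $n$ vertices and maximum degree at most $\Delta$, there is such a graph $G$ on which the expected number of queries of the algorithm is at least $c/\epsilon^2$. -/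

import Mathlib

open MeasureTheory ProbabilityTheory

/-! ### Multigraphs given by adjacency lists -/

/-- A finite undirected multigraph on the vertex set `Fin n`, parallel edges and self-loops allowed,
together with its representation by adjacency lists. `adj v` lists the edges at `v` in the order in
which the oracles present them. A non-loop edge occurs exactly once in the list of each of its two
endpoints; a self-loop occurs in the list of its endpoint once or twice, so that both conventions
for the contribution of a self-loop to the degree are covered. -/
structure OracleGraph (n : ℕ) where
  /-- number of edges -/
  m : ℕ
  /-- the unordered pair of endpoints of an edge -/
  ends : Fin m → Sym2 (Fin n)
  /-- the adjacency lists -/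
  adj : Fin n → List (Fin m)
  mem_adj : ∀ v e, e ∈ adj v ↔ v ∈ ends e
  count_le_one : ∀ v e, ¬ (ends e).IsDiag → (adj v).count e ≤ 1
  count_le_two : ∀ v e, (adj v).count e ≤ 2

namespace OracleGraph

variable {n : ℕ} (G : OracleGraph n)

/-- The answer of the degree oracle `𝒟(v)`. -/
def degree (v : Fin n) : ℕ := (G.adj v).length

open Classical in
/-- The endpoint of `e` other than `v` (which is `v` itself if `e` is a self-loop at `v`). -/
noncomputable def other (v : Fin n) (e : Fin G.m) : Fin n :=
  if h : v ∈ G.ends e then Sym2.Mem.other h else v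

/-- The answer of the neighbour oracle `𝒩(v, i)`, with `i` counted from `0`; the answer is `none`
if `i` is not smaller than the degree of `v`. -/
noncomputable def neighbor (v : Fin n) (i : ℕ) : Option (Fin n) :=
  ((G.adj v)[i]?).map (G.other v)

/-- All degrees are at most `Δ`. -/
def MaxDegreeLE (Δ : ℕ) : Prop := ∀ v, G.degree v ≤ Δ

/-- A matching is a set of edges no two of which share an endpoint. An edge of a matching (a dimer)
occupies two vertices, so self-loops are not used. -/
def IsMatching (M : Finset (Fin G.m)) : Prop :=
  (∀ e ∈ M, ¬ (G.ends e).IsDiag) ∧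
    ∀ e ∈ M, ∀ f ∈ M, ∀ v, v ∈ G.ends e → v ∈ G.ends f → e = f

open Classical in
/-- The finite set of all matchings. -/
noncomputable def matchings : Finset (Finset (Fin G.m)) :=
  Finset.univ.filter G.IsMatching

/-- The partition function `Z(G, lam) = ∑_M lam ^ |M|`. -/
noncomputable def partitionFunction (lam : ℝ) : ℝ := ∑ M ∈ G.matchings, lam ^ M.card

/-- The Gibbs distribution `π_{G, lam}(M) = lam ^ |M| / Z(G, lam)` on matchings. -/
noncomputable def gibbs (lam : ℝ) (M : Finset (Fin G.m)) : ℝ :=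
  lam ^ M.card / G.partitionFunction lam

/-- The average size `E(G, lam) = ∑_M |M| π_{G, lam}(M)` of a matching. -/
noncomputable def expectedMatchingSize (lam : ℝ) : ℝ :=
  ∑ M ∈ G.matchings, (M.card : ℝ) * G.gibbs lam M

end OracleGraph

/-! ### Query algorithms -/

/-- A deterministic algorithm on graphs with vertex set `Fin n`, as an adaptive decision tree: it
stops with an output, or it accesses one of the two oracles and continues depending on the answer.
-/
inductive QueryProg (n : ℕ) (α : Type) : Type
  | ret (a : α) : QueryProg n α
  | queryDegree (v : Fin n) (k : ℕ → QueryProg n α) : QueryProg n α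
  | queryNeighbor (v : Fin n) (i : ℕ) (k : Option (Fin n) → QueryProg n α) : QueryProg n α

namespace QueryProg

variable {n : ℕ} {α β : Type}

/-- Sequential composition: run the first program, then continue with its output. -/
def bind : QueryProg n α → (α → QueryProg n β) → QueryProg n β
  | ret a, f => f a
  | queryDegree v k, f => queryDegree v fun d => (k d).bind f
  | queryNeighbor v i k, f => queryNeighbor v i fun t => (k t).bind f

instance : Monad (QueryProg n) where
  pure := ret
  bind := bind

/-- Access to the oracle `𝒟`. -/
def getDegree (v : Fin n) : QueryProg n ℕ := queryDegree v ret

/-- Access to the oracle `𝒩`. -/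
def getNeighbor (v : Fin n) (i : ℕ) : QueryProg n (Option (Fin n)) := queryNeighbor v i ret

/-- The output of a program on a graph. -/
noncomputable def output (G : OracleGraph n) : QueryProg n α → α
  | ret a => a
  | queryDegree v k => (k (G.degree v)).output G
  | queryNeighbor v i k => (k (G.neighbor v i)).output G

/-- The number of accesses to the oracles that a program makes on a graph. -/
noncomputable def queries (G : OracleGraph n) : QueryProg n α → ℕ
  | ret _ => 0
  | queryDegree v k => (k (G.degree v)).queries G + 1
  | queryNeighbor v i k => (k (G.neighbor v i)).queries G + 1

end QueryProg

/-- A randomized algorithm with real output on graphs with vertex set `Fin n`: an arbitrary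
probability space, and a deterministic algorithm for each of its points. -/
structure RandAlgorithm (n : ℕ) where
  /-- the outcomes of the internal randomness -/
  Ω : Type
  [mΩ : MeasurableSpace Ω]
  /-- the law of the internal randomness -/
  P : Measure Ω
  [prob : IsProbabilityMeasure P]
  /-- the deterministic algorithm run on an outcome -/
  prog : Ω → QueryProg n ℝ
  measurable_output : ∀ G : OracleGraph n, Measurable fun ω => (prog ω).output G
  measurable_queries : ∀ G : OracleGraph n, Measurable fun ω => (prog ω).queries G

namespace RandAlgorithm

attribute [instance] RandAlgorithm.mΩ RandAlgorithm.prob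

variable {n : ℕ}

/-- On every graph of the class `𝒢` the algorithm outputs, with probability at least `p`, a number
that differs from `val G` by at most `err`. -/
def IsApproximation (A : RandAlgorithm n) (𝒢 : Set (OracleGraph n)) (val : OracleGraph n → ℝ)
    (err p : ℝ) : Prop :=
  ∀ G ∈ 𝒢, ENNReal.ofReal p ≤ A.P {ω | |(A.prog ω).output G - val G| ≤ err}

/-- The average number of queries on `G` (over the internal randomness). -/
noncomputable def expectedQueries (A : RandAlgorithm n) (G : OracleGraph n) : ENNReal :=
  ∫⁻ ω, ((A.prog ω).queries G : ENNReal) ∂A.P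

end RandAlgorithm

/-! ### The algorithm Approx-Matching-Statistics -/

section Algorithm

variable {n : ℕ}

/-- The depth-first search on the path-tree, truncated at level `h`: `dfs lam k s path` is
`DFS(lam, h, s, ℓ)` with `k = h - ℓ` remaining levels, where `path` holds the `ℓ - 1` vertices
visited before `s`. It evaluates the recursion `x = 1 / (1 + lam * ∑ x_child)`, with the value `1`
at level `h`. -/
noncomputable def dfs (lam : ℝ) : ℕ → Fin n → List (Fin n) → QueryProg n ℝ
  | 0, _, _ => pure 1
  | k + 1, s, path => do
      let d ← QueryProg.getDegree s
      let A ← (List.range d).foldlM (init := (1 : ℝ)) fun A i => do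
        match ← QueryProg.getNeighbor s i with
        | none => pure A
        | some t =>
            if t ∈ s :: path then pure A
            else do
              let x ← dfs lam k t (s :: path)
              pure (A + lam * x)
      pure (1 / A)

/-- The loop of `Approx-Marginal`: with `xprev = x[h-1]` and `xcur = x[h]`, compute `x[h+1]`, and
so on, as long as two consecutive values differ by more than the threshold on the logarithmic
scale. At most `fuel` further values are computed; see `approxMarginalLoop_fuel`. -/
noncomputable def approxMarginalLoop (lam ε : ℝ) (v : Fin n) :
    (fuel h : ℕ) → (xprev xcur : ℝ) → QueryProg n ℝ
  | 0, _, _, xcur => pure xcur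
  | fuel + 1, h, xprev, xcur =>
      if |Real.log xcur - Real.log xprev| > ε / Real.exp 1 then do
        let x ← dfs lam h v []
        approxMarginalLoop lam ε v fuel (h + 1) xcur x
      else pure xcur

/-- `Approx-Marginal(lam, ε, v)`. A simple path has at most `n` vertices, so `x[n+2] = x[n+1]` and
the loop stops by itself before the `n` further iterations allowed here are exceeded. -/
noncomputable def approxMarginal (lam ε : ℝ) (v : Fin n) : QueryProg n ℝ := do
  let x1 ← dfs lam 0 v []
  let x2 ← dfs lam 1 v []
  approxMarginalLoop lam ε v n 2 x1 x2

/-- The deterministic part of `Approx-Matching-Statistics(lam, ε)`, once the `s` vertices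
`U 0, …, U (s - 1)` have been sampled. -/
noncomputable def matchingStatisticsProg (lam ε : ℝ) {s : ℕ} (U : Fin s → Fin n) :
    QueryProg n ℝ := do
  let S ← (List.ofFn U).foldlM (init := (0 : ℝ)) fun S u => do
    let x ← approxMarginal lam (ε / 2) u
    pure (S + x)
  pure ((n : ℝ) / 2 - (n : ℝ) / (2 * s) * S)

/-- `Approx-Matching-Statistics(lam, ε)` with the constant `C`: sample `s = ⌈C / ε ^ 2⌉` vertices
independently and uniformly at random, and run the deterministic part on them. -/
noncomputable def approxMatchingStatistics (C lam ε : ℝ) (n : ℕ) [NeZero n] : RandAlgorithm n where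
  Ω := Fin ⌈C / ε ^ 2⌉₊ → Fin n
  P := Measure.pi fun _ => uniformOn (Set.univ : Set (Fin n))
  prob := by
    have : IsProbabilityMeasure (uniformOn (Set.univ : Set (Fin n))) :=
      isProbabilityMeasure_uniformOn Set.finite_univ Set.univ_nonempty
    infer_instance
  prog := fun U => matchingStatisticsProg lam ε U
  measurable_output := fun _ => measurable_of_countable _
  measurable_queries := fun _ => measurable_of_countable _

/-! The bound on the number of iterations in `approxMarginal` has no effect. -/

theorem QueryProg.output_bind {α β : Type} (G : OracleGraph n) (p : QueryProg n α)
    (f : α → QueryProg n β) : (p >>= f).output G = (f (p.output G)).output G := by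
  change (p.bind f).output G = _
  induction p with
  | ret a => rfl
  | queryDegree v k ih => exact ih _
  | queryNeighbor v i k ih => exact ih _

theorem QueryProg.queries_bind {α β : Type} (G : OracleGraph n) (p : QueryProg n α)
    (f : α → QueryProg n β) :
    (p >>= f).queries G = p.queries G + (f (p.output G)).queries G := by
  change (p.bind f).queries G = _
  induction p with
  | ret a => simp [QueryProg.bind, QueryProg.queries, QueryProg.output]
  | queryDegree v k ih => simp only [QueryProg.bind, QueryProg.queries, QueryProg.output, ih]; ring
  | queryNeighbor v i k ih =>
      simp only [QueryProg.bind, QueryProg.queries, QueryProg.output, ih]; ring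

theorem QueryProg.output_foldlM_congr {ι : Type} (G : OracleGraph n)
    (f g : ℝ → ι → QueryProg n ℝ) (h : ∀ a i, (f a i).output G = (g a i).output G)
    (l : List ι) (a : ℝ) : (l.foldlM f a).output G = (l.foldlM g a).output G := by
  induction l generalizing a with
  | nil => rfl
  | cons i l ih =>
      simp only [List.foldlM_cons, QueryProg.output_bind, h]
      exact ih _

/-- The search is not truncated as soon as the number of levels exceeds the number of vertices. -/
theorem dfs_output_succ (G : OracleGraph n) (lam : ℝ) (k : ℕ) (s : Fin n) (path : List (Fin n))
    (hnd : (s :: path).Nodup) (hk : n ≤ path.length + k) :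
    (dfs lam (k + 1) s path).output G = (dfs lam k s path).output G := by
  induction k generalizing s path with
  | zero =>
      have := hnd.length_le_card
      simp at this
      omega
  | succ k ih =>
      rw [dfs, dfs]
      simp only [QueryProg.output_bind]
      refine congrArg (fun y : ℝ => 1 / y) ?_
      apply QueryProg.output_foldlM_congr
      intro a i
      simp only [QueryProg.output_bind]
      cases (QueryProg.getNeighbor s i).output G with
      | none => rfl
      | some t =>
          by_cases ht : t ∈ s :: path
          · simp only [ht, if_true]
          · simp only [ht, if_false, QueryProg.output_bind]
            rw [ih t (s :: path) (List.nodup_cons.2 ⟨ht, hnd⟩) (by simp; omega)]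

theorem approxMarginalLoop_fuel_aux (G : OracleGraph n) (lam ε : ℝ) (hε : 0 < ε) (v : Fin n)
    (extra fuel h : ℕ) (hh : n + 2 ≤ fuel + h) (h2 : 2 ≤ h) (xp xc : ℝ)
    (hp : xp = (dfs lam (h - 2) v []).output G) (hc : xc = (dfs lam (h - 1) v []).output G) :
    (approxMarginalLoop lam ε v (fuel + extra) h xp xc).output G =
        (approxMarginalLoop lam ε v fuel h xp xc).output G ∧
      (approxMarginalLoop lam ε v (fuel + extra) h xp xc).queries G =
        (approxMarginalLoop lam ε v fuel h xp xc).queries G := by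
  induction fuel generalizing h xp xc with
  | zero =>
      obtain ⟨j, rfl⟩ : ∃ j, h = j + 2 := ⟨h - 2, by omega⟩
      have hx : xc = xp := by
        rw [hp, hc]
        exact dfs_output_succ G lam j v [] (by simp) (by simp; omega)
      cases extra with
      | zero => simp
      | succ e =>
          have : ¬ (|Real.log xc - Real.log xp| > ε / Real.exp 1) := by
            simp only [hx, sub_self, abs_zero, gt_iff_lt, not_lt]
            positivity
          have h1 : approxMarginalLoop lam ε v (0 + (e + 1)) (j + 2) xp xc = pure xc := by
            rw [Nat.zero_add]
            exact if_neg this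
          rw [h1]
          exact ⟨rfl, rfl⟩
  | succ fuel ih =>
      rw [Nat.succ_add_eq_add_succ, Nat.add_succ, approxMarginalLoop, approxMarginalLoop]
      split_ifs
      · simp only [QueryProg.output_bind, QueryProg.queries_bind]
        have := ih (h + 1) (by omega) (by omega) xc ((dfs lam h v []).output G) hc rfl
        exact ⟨this.1, by rw [this.2]⟩
      · exact ⟨rfl, rfl⟩

/-- Allowing more than `n` further iterations changes neither the output of `Approx-Marginal` nor
the number of its queries: the loop has stopped before. -/
theorem approxMarginalLoop_fuel (G : OracleGraph n) (lam ε : ℝ) (hε : 0 < ε) (v : Fin n)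
    (extra : ℕ) (xp xc : ℝ)
    (hp : xp = (dfs lam 0 v []).output G) (hc : xc = (dfs lam 1 v []).output G) :
    (approxMarginalLoop lam ε v (n + extra) 2 xp xc).output G =
        (approxMarginalLoop lam ε v n 2 xp xc).output G ∧
      (approxMarginalLoop lam ε v (n + extra) 2 xp xc).queries G =
        (approxMarginalLoop lam ε v n 2 xp xc).queries G :=
  approxMarginalLoop_fuel_aux G lam ε hε v extra n 2 le_rfl le_rfl xp xc hp hc

end Algorithm

/-! Upper bound. Counting vertices by whether a matching covers them gives `E = n/2 - (1/2) ∑_v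
μ_v`, where `μ_v` is the probability that `v` is unmatched, so it suffices to average estimates of
`μ_v` over a random sample (`expectedMatchingSize_eq`, `measure_sample_sum_le`). Splitting matchings
according to the edge that covers `s` shows that the marginals satisfy the same recursion on the
path-tree as `dfs` (`marginal_rec`, `dfs_output_rec`). The recursion map is antitone, and the
boundary value `1` is an upper bound for every marginal, so successive truncations lie alternately
above and below `μ_v` (`dfs_output_sandwich`). Two consecutive values that are close therefore
certify their own accuracy: the stopping rule is sound on every graph, without a degree bound.

The degree enters only the running time. On the logarithmic scale two levels of the recursion
contract by `1 - 2 / (√(1 + lam * Δ) + 1)` (`abs_log_two_step_le`), so a depth of order `√Δ (log Δ +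
log (1/ε))`, for fixed `lam`, triggers the stopping rule, and a search of depth `h` costs `O(Δ ^ h)`
queries.

Lower bound. Among `⌊n/2⌋` disjoint vertex pairs, let each carry an edge independently with
probability `(1 + δ)/2` or `(1 - δ)/2`, with `δ` of order `ε`. The expected matching size is
proportional to the number of edges, so an accurate algorithm tells the two biases apart. Each query
reveals at most one biased bit. Induction along the decision tree (`AffinityBound.step`,
`affinityBound_queryProg`) bounds the loss of Hellinger affinity between the two output laws by `δ ^
2` times the expected number of queries, so a constant advantage forces order `1 / δ ^ 2` queries.
-/

/-! ### The recursion evaluated by the depth-first search -/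

namespace QueryProg

variable {n : ℕ} {ι : Type}

theorem output_foldlM_add (G : OracleGraph n) (f : ℝ → ι → QueryProg n ℝ) (g : ι → ℝ)
    (h : ∀ a i, (f a i).output G = a + g i) (l : List ι) (a : ℝ) :
    (l.foldlM f a).output G = a + (l.map g).sum := by
  induction l generalizing a with
  | nil => simp [output, pure]
  | cons i l ih =>
      simp only [List.foldlM_cons, output_bind, h, ih, List.map_cons, List.sum_cons]
      ring

theorem queries_foldlM_le (G : OracleGraph n) (f : ℝ → ι → QueryProg n ℝ) (c : ℕ)
    (h : ∀ a i, (f a i).queries G ≤ c) (l : List ι) (a : ℝ) :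
    (l.foldlM f a).queries G ≤ l.length * c := by
  induction l generalizing a with
  | nil => simp [queries, pure]
  | cons i l ih =>
      simp only [List.foldlM_cons, queries_bind, List.length_cons]
      have := ih ((f a i).output G)
      have := h a i
      linarith [Nat.succ_mul l.length c]

end QueryProg

theorem List.sum_map_range_getElem_option {α : Type*} (l : List α) (g : Option α → ℝ) :
    ((List.range l.length).map fun i => g l[i]?).sum = (l.map fun e => g (some e)).sum := by
  induction l with
  | nil => simp
  | cons a l ih => simp [List.range_succ_eq_map, List.map_map, Function.comp_def, ih]

namespace OracleGraph

variable {n : ℕ} (G : OracleGraph n)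

open Classical in
/-- The edges from `s` to a vertex that is neither `s` nor on `path`. -/
noncomputable def childEdges (s : Fin n) (path : List (Fin n)) : Finset (Fin G.m) :=
  Finset.univ.filter fun e => s ∈ G.ends e ∧ G.other s e ∉ s :: path

theorem ends_eq {s : Fin n} {e : Fin G.m} (h : s ∈ G.ends e) : G.ends e = s(s, G.other s e) := by
  rw [other, dif_pos h, Sym2.other_spec]

theorem count_eq_one {s : Fin n} {path : List (Fin n)} {e : Fin G.m}
    (h : e ∈ G.childEdges s path) : (G.adj s).count e = 1 := by
  simp only [childEdges, Finset.mem_filter, Finset.mem_univ, true_and, List.mem_cons,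
    not_or] at h
  refine le_antisymm (G.count_le_one s e ?_) (List.count_pos_iff.2 ((G.mem_adj s e).2 h.1))
  rw [G.ends_eq h.1, Sym2.mk_isDiag_iff]
  exact fun h' => h.2.1 h'.symm

-- A self-loop at `s` has other endpoint `s`, which lies on `s :: path`, so it contributes `0`
-- whether it is listed once or twice. Every remaining edge is listed exactly once, and the list sum
-- becomes a sum over a set of edges.
open Classical in
theorem sum_adj_eq (s : Fin n) (path : List (Fin n)) (g : Fin G.m → ℝ) :
    ((G.adj s).map fun e => if G.other s e ∈ s :: path then 0 else g e).sum =
      ∑ e ∈ G.childEdges s path, g e := by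
  rw [Finset.sum_list_map_count]
  symm
  refine Finset.sum_subset_zero_on_sdiff (fun e he => ?_) (fun e he => ?_) fun e he => ?_
  · simp only [childEdges, Finset.mem_filter] at he
    exact List.mem_toFinset.2 ((G.mem_adj s e).2 he.2.1)
  · simp only [childEdges, Finset.mem_sdiff, List.mem_toFinset, G.mem_adj, Finset.mem_filter,
      Finset.mem_univ, true_and, not_and, not_not] at he
    rw [if_pos (he.2 he.1), smul_zero]
  · rw [G.count_eq_one he, one_smul, if_neg]
    simp only [childEdges, Finset.mem_filter] at he
    exact he.2.2

theorem card_childEdges_le (s : Fin n) (path : List (Fin n)) :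
    (G.childEdges s path).card ≤ G.degree s := by
  classical
  refine (Finset.card_le_card fun e he => ?_).trans (List.toFinset_card_le (G.adj s))
  simp only [childEdges, Finset.mem_filter] at he
  exact List.mem_toFinset.2 ((G.mem_adj s e).2 he.2.1)

end OracleGraph

section Recursion

variable {n : ℕ} (G : OracleGraph n) (lam : ℝ)

theorem dfs_output_zero (s : Fin n) (path : List (Fin n)) :
    (dfs lam 0 s path).output G = 1 := by
  rw [dfs]; rfl

theorem dfs_output_rec (k : ℕ) (s : Fin n) (path : List (Fin n)) :
    (dfs lam (k + 1) s path).output G =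
      1 / (1 + lam * ∑ e ∈ G.childEdges s path,
        (dfs lam k (G.other s e) (s :: path)).output G) := by
  classical
  rw [dfs]
  simp only [QueryProg.output_bind]
  refine congrArg (fun y : ℝ => 1 / y) ?_
  rw [QueryProg.output_foldlM_add G _ (fun i => ((G.adj s)[i]?).elim 0 fun e =>
    if G.other s e ∈ s :: path then 0
    else lam * (dfs lam k (G.other s e) (s :: path)).output G)]
  · change 1 + ((List.range (G.adj s).length).map _).sum = _
    rw [List.sum_map_range_getElem_option (G.adj s) fun o => o.elim 0 fun e =>
      if G.other s e ∈ s :: path then 0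
      else lam * (dfs lam k (G.other s e) (s :: path)).output G]
    simp only [Option.elim_some]
    rw [G.sum_adj_eq, Finset.mul_sum]
  · intro a i
    simp only [QueryProg.output_bind]
    change QueryProg.output G (match G.neighbor s i with | none => _ | some t => _) = _
    rw [OracleGraph.neighbor]
    cases (G.adj s)[i]? with
    | none => exact (add_zero a).symm
    | some e =>
        simp only [Option.map_some, Option.elim_some]
        split_ifs with h
        · exact (add_zero a).symm
        · rw [QueryProg.output_bind]; rfl

theorem dfs_output_pos (hlam : 0 ≤ lam) (k : ℕ) (s : Fin n) (path : List (Fin n)) :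
    0 < (dfs lam k s path).output G := by
  induction k generalizing s path with
  | zero => rw [dfs_output_zero]; exact one_pos
  | succ k ih =>
      rw [dfs_output_rec]
      have := Finset.sum_nonneg fun e (_ : e ∈ G.childEdges s path) =>
        (ih (G.other s e) (s :: path)).le
      positivity

theorem dfs_output_le_one (hlam : 0 ≤ lam) (k : ℕ) (s : Fin n) (path : List (Fin n)) :
    (dfs lam k s path).output G ≤ 1 := by
  cases k with
  | zero => rw [dfs_output_zero]
  | succ k =>
      rw [dfs_output_rec]
      have := mul_nonneg hlam (Finset.sum_nonneg fun e (_ : e ∈ G.childEdges s path) =>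
        (dfs_output_pos G lam hlam k (G.other s e) (s :: path)).le)
      rw [div_le_one (by linarith)]
      linarith

/-- A node costs one degree query and, per neighbour, one query and one subtree. The offset `3`
makes the induction close: `1 + Δ (3 Δ ^ k - 2) + 3 ≤ 3 Δ ^ (k + 1)` is `2 Δ ≥ 4`. -/
theorem dfs_queries_le {Δ : ℕ} (hΔ : 2 ≤ Δ) (hG : G.MaxDegreeLE Δ) (k : ℕ) (s : Fin n)
    (path : List (Fin n)) : (dfs lam k s path).queries G + 3 ≤ 3 * Δ ^ k := by
  induction k generalizing s path with
  | zero => rw [dfs]; simp [QueryProg.queries, pure]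
  | succ k ih =>
      rw [dfs]
      simp only [QueryProg.queries_bind]
      have key := QueryProg.queries_foldlM_le G (fun (A : ℝ) i => do
        match ← QueryProg.getNeighbor s i with
        | none => pure A
        | some t =>
            if t ∈ s :: path then pure A
            else do
              let x ← dfs lam k t (s :: path)
              pure (A + lam * x)) (3 * Δ ^ k - 2) ?_ (List.range (G.degree s)) 1
      · change 1 + ((_ : ℕ) + 0) + 3 ≤ _
        rw [List.length_range] at key
        have h1 : 1 ≤ Δ ^ k := Nat.one_le_pow _ _ (by omega)
        obtain ⟨x, hx⟩ : ∃ x, Δ ^ k = x + 1 := ⟨Δ ^ k - 1, by omega⟩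
        have h2 := key.trans (Nat.mul_le_mul_right _ (hG s))
        rw [pow_succ]
        rw [hx] at h2 ⊢
        have h3 : 3 * (x + 1) - 2 = 3 * x + 1 := by omega
        rw [h3] at h2
        refine (Nat.add_le_add_right (Nat.add_le_add_left h2 1) 3).trans ?_
        nlinarith
      · intro a i
        rw [QueryProg.queries_bind]
        have h1 : 1 ≤ Δ ^ k := Nat.one_le_pow _ _ (by omega)
        have h0 : (QueryProg.getNeighbor s i).queries G = 1 := rfl
        rw [h0]
        cases (QueryProg.getNeighbor s i).output G with
        | none => change 1 + 0 ≤ _; omega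
        | some t =>
            simp only
            split_ifs with h
            · change 1 + 0 ≤ _; omega
            · rw [QueryProg.queries_bind]
              have := ih t (s :: path)
              change 1 + ((_ : ℕ) + 0) ≤ _
              omega

end Recursion

/-! ### Marginals of the Gibbs distribution -/

namespace OracleGraph

variable {n : ℕ} (G : OracleGraph n) (lam : ℝ)

open Classical in
/-- The matchings that leave all vertices of `P` unmatched. -/
noncomputable def matchingsAvoiding (P : List (Fin n)) : Finset (Finset (Fin G.m)) :=
  G.matchings.filter fun M => ∀ e ∈ M, ∀ v ∈ P, v ∉ G.ends e

/-- The partition function of the graph without the vertices of `P`. -/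
noncomputable def zAvoiding (P : List (Fin n)) : ℝ :=
  ∑ M ∈ G.matchingsAvoiding P, lam ^ M.card

theorem mem_matchingsAvoiding {P : List (Fin n)} {M : Finset (Fin G.m)} :
    M ∈ G.matchingsAvoiding P ↔ G.IsMatching M ∧ ∀ e ∈ M, ∀ v ∈ P, v ∉ G.ends e := by
  simp [matchingsAvoiding, matchings]

theorem zAvoiding_nil : G.zAvoiding lam [] = G.partitionFunction lam := by
  rw [zAvoiding, partitionFunction, matchingsAvoiding]
  simp

theorem zAvoiding_pos (hlam : 0 < lam) (P : List (Fin n)) : 0 < G.zAvoiding lam P := by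
  refine Finset.sum_pos (fun M _ => pow_pos hlam _) ⟨∅, ?_⟩
  rw [mem_matchingsAvoiding]
  simp [IsMatching]

theorem IsMatching.subset {M N : Finset (Fin G.m)} (hM : G.IsMatching M) (h : N ⊆ M) :
    G.IsMatching N :=
  ⟨fun e he => hM.1 e (h he), fun e he f hf => hM.2 e (h he) f (h hf)⟩

/-- A matching avoiding `P` either misses `s` or covers it by a unique edge `e`. Removing `e` leaves
a matching that also avoids both ends of `e`, at the price of a factor `lam`. -/
theorem zAvoiding_rec (s : Fin n) (P : List (Fin n)) (hs : s ∉ P) :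
    G.zAvoiding lam P = G.zAvoiding lam (s :: P) +
      lam * ∑ e ∈ G.childEdges s P, G.zAvoiding lam (G.other s e :: s :: P) := by
  classical
  have h1 : (G.matchingsAvoiding P).filter (fun M => ∀ e ∈ M, s ∉ G.ends e) =
      G.matchingsAvoiding (s :: P) := by
    ext M
    simp only [Finset.mem_filter, mem_matchingsAvoiding, List.forall_mem_cons]
    grind
  rw [zAvoiding, ← Finset.sum_filter_add_sum_filter_not _ (fun M => ∀ e ∈ M, s ∉ G.ends e), h1,
    zAvoiding]
  congr 1
  simp only [zAvoiding, Finset.mul_sum]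
  rw [Finset.sum_sigma']
  symm
  have hne : ∀ e ∈ G.childEdges s P, ∀ M ∈ G.matchingsAvoiding (G.other s e :: s :: P), e ∉ M := by
    intro e he M hM heM
    simp only [childEdges, Finset.mem_filter] at he
    exact (G.mem_matchingsAvoiding.1 hM).2 e heM s (by simp) he.2.1
  refine Finset.sum_bij (fun x _ => insert x.1 x.2) ?_ ?_ ?_ ?_
  · rintro ⟨e, M⟩ hx
    rw [Finset.mem_sigma] at hx
    obtain ⟨he, hM⟩ := hx
    simp only [childEdges, Finset.mem_filter, Finset.mem_univ, true_and, List.mem_cons,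
      not_or] at he
    simp only [mem_matchingsAvoiding, List.forall_mem_cons] at hM
    obtain ⟨hse, hos, hoP⟩ := he
    have hends := G.ends_eq hse
    have hmem : ∀ v, v ∈ G.ends e ↔ v = s ∨ v = G.other s e := by
      intro v
      conv_lhs => rw [hends]
      exact Sym2.mem_iff
    simp only [Finset.mem_filter, mem_matchingsAvoiding, not_forall, not_not]
    refine ⟨⟨⟨?_, ?_⟩, ?_⟩, e, Finset.mem_insert_self _ _, hse⟩
    · intro f hf
      rcases Finset.mem_insert.1 hf with rfl | hf
      · rw [hends, Sym2.mk_isDiag_iff]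
        exact fun h => hos h.symm
      · exact hM.1.1 f hf
    · have hdis : ∀ f ∈ M, ∀ v, v ∈ G.ends e → v ∈ G.ends f → False := by
        intro f hf v hv hv'
        rcases (hmem v).1 hv with rfl | rfl
        · exact (hM.2 f hf).2.1 hv'
        · exact (hM.2 f hf).1 hv'
      intro f hf g hg v hv hv'
      rcases Finset.mem_insert.1 hf with rfl | hfM
      · rcases Finset.mem_insert.1 hg with rfl | hgM
        · rfl
        · exact (hdis g hgM v hv hv').elim
      · rcases Finset.mem_insert.1 hg with rfl | hgM
        · exact (hdis f hfM v hv' hv).elim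
        · exact hM.1.2 f hfM g hgM v hv hv'
    · intro f hf v hv
      rcases Finset.mem_insert.1 hf with rfl | hf
      · rw [hmem]
        rintro (rfl | rfl)
        · exact hs hv
        · exact hoP hv
      · exact (hM.2 f hf).2.2 v hv
  · rintro ⟨e, M⟩ hx ⟨e', M'⟩ hx' h
    rw [Finset.mem_sigma] at hx hx'
    simp only at h hx hx'
    have hee : e = e' := by
      have : e ∈ insert e' M' := h ▸ Finset.mem_insert_self _ _
      rcases Finset.mem_insert.1 this with h' | h'
      · exact h'
      · have he := hx.1
        simp only [childEdges, Finset.mem_filter] at he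
        exact ((G.mem_matchingsAvoiding.1 hx'.2).2 e h' s (by simp) he.2.1).elim
    subst hee
    have : M = M' := by
      rw [← Finset.erase_insert (hne e hx.1 M hx.2), h, Finset.erase_insert (hne e hx'.1 M' hx'.2)]
    rw [this]
  · intro M hM
    simp only [Finset.mem_filter, mem_matchingsAvoiding, not_forall, not_not] at hM
    obtain ⟨⟨hM, hP⟩, e, he, hse⟩ := hM
    have hends := G.ends_eq hse
    have ho : G.other s e ∈ G.ends e := by
      exact hends ▸ Sym2.mem_mk_right s (G.other s e)
    refine ⟨⟨e, M.erase e⟩, ?_, Finset.insert_erase he⟩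
    simp only [Finset.mem_sigma, mem_matchingsAvoiding, childEdges, Finset.mem_filter,
      Finset.mem_univ, true_and, List.mem_cons, not_or]
    refine ⟨⟨hse, fun h => hM.1 e he ?_, fun h => hP e he _ h ho⟩,
      IsMatching.subset G hM (Finset.erase_subset _ _), ?_⟩
    · rw [hends, Sym2.mk_isDiag_iff, h]
    · intro f hf v hv hvf
      obtain ⟨hfe, hf⟩ := Finset.mem_erase.1 hf
      rcases hv with rfl | rfl | hv
      · exact hfe (hM.2 f hf e he _ hvf ho)
      · exact hfe (hM.2 f hf e he _ hvf hse)
      · exact hP f hf v hv hvf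
  · rintro ⟨e, M⟩ hx
    rw [Finset.mem_sigma] at hx
    simp only
    rw [Finset.card_insert_of_notMem (hne e hx.1 M hx.2), pow_succ, mul_comm]

/-- The probability that `s` is unmatched in the graph without the vertices of `P`. -/
noncomputable def marginal (s : Fin n) (P : List (Fin n)) : ℝ :=
  G.zAvoiding lam (s :: P) / G.zAvoiding lam P

theorem marginal_pos (hlam : 0 < lam) (s : Fin n) (P : List (Fin n)) : 0 < G.marginal lam s P :=
  div_pos (G.zAvoiding_pos lam hlam _) (G.zAvoiding_pos lam hlam _)

/-- This is `zAvoiding_rec` divided by `Z(s :: P)`. Each ratio on the right is the marginal of a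
neighbour once `s` has been deleted as well, which is why the search extends its path. -/
theorem marginal_rec (hlam : 0 < lam) (s : Fin n) (P : List (Fin n)) (hs : s ∉ P) :
    G.marginal lam s P =
      1 / (1 + lam * ∑ e ∈ G.childEdges s P, G.marginal lam (G.other s e) (s :: P)) := by
  have h1 := (G.zAvoiding_pos lam hlam (s :: P)).ne'
  simp only [marginal]
  rw [← Finset.sum_div, G.zAvoiding_rec lam s P hs, one_div, ← mul_div_assoc, one_add_div h1,
    inv_div]

theorem marginal_le_one (hlam : 0 < lam) (s : Fin n) (P : List (Fin n)) (hs : s ∉ P) :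
    G.marginal lam s P ≤ 1 := by
  rw [marginal, div_le_one (G.zAvoiding_pos lam hlam P), G.zAvoiding_rec lam s P hs]
  have := mul_nonneg hlam.le (Finset.sum_nonneg fun e (_ : e ∈ G.childEdges s P) =>
    (G.zAvoiding_pos lam hlam (G.other s e :: s :: P)).le)
  linarith

/-- Double counting of incidences: a vertex is either unmatched or on exactly one edge of `M`, and
every edge of `M`, not being a loop, has two vertices. -/
theorem two_mul_card_add_card_unmatched {M : Finset (Fin G.m)} (hM : G.IsMatching M) :
    2 * M.card + (∑ v : Fin n, if M ∈ G.matchingsAvoiding [v] then 1 else 0) = n := by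
  classical
  have h1 : ∀ e ∈ M, (Finset.univ.filter fun v => v ∈ G.ends e).card = 2 := by
    intro e he
    have h2 := hM.1 e he
    rw [← Sym2.card_toFinset_of_not_isDiag _ h2]
    congr 1
    ext v
    simp
  have h3 : ∀ v : Fin n, ((if M ∈ G.matchingsAvoiding [v] then 1 else 0) +
      ∑ e ∈ M, if v ∈ G.ends e then 1 else 0 : ℕ) = 1 := by
    intro v
    by_cases h : ∃ e ∈ M, v ∈ G.ends e
    · obtain ⟨e, he, hv⟩ := h
      rw [if_neg, Finset.sum_eq_single_of_mem e he, if_pos hv]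
      · intro f hf hfe
        exact if_neg fun hvf => hfe (hM.2 f hf e he v hvf hv)
      · rw [mem_matchingsAvoiding]
        exact fun h => h.2 e he v (by simp) hv
    · push Not at h
      have hv : M ∈ G.matchingsAvoiding [v] := by
        rw [mem_matchingsAvoiding]
        refine ⟨hM, fun e he w hw => ?_⟩
        rw [List.mem_singleton.1 hw]
        exact h e he
      rw [if_pos hv, Finset.sum_eq_zero fun e he => if_neg (h e he), add_zero]
  have h4 := Finset.sum_congr rfl fun v (_ : v ∈ Finset.univ) => h3 v
  rw [Finset.sum_add_distrib, Finset.sum_comm] at h4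
  have h5 : ∑ e ∈ M, ∑ v : Fin n, (if v ∈ G.ends e then 1 else 0) = 2 * M.card := by
    rw [Finset.sum_congr rfl fun e he => (Finset.card_filter _ _).symm.trans (h1 e he)]
    simp [mul_comm]
  rw [h5] at h4
  simp only [Finset.sum_const, Finset.card_univ, Fintype.card_fin, smul_eq_mul, mul_one] at h4
  omega

theorem expectedMatchingSize_eq (hlam : 0 < lam) :
    G.expectedMatchingSize lam = (n : ℝ) / 2 - 1 / 2 * ∑ v, G.marginal lam v [] := by
  classical
  have hZ := G.zAvoiding_nil lam ▸ G.zAvoiding_pos lam hlam []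
  have h1 : ∀ v, G.marginal lam v [] =
      ∑ M ∈ G.matchings, (if M ∈ G.matchingsAvoiding [v] then 1 else 0) * G.gibbs lam M := by
    intro v
    rw [marginal, zAvoiding_nil, zAvoiding, Finset.sum_div]
    simp only [ite_mul, one_mul, zero_mul]
    rw [← Finset.sum_filter]
    refine Finset.sum_congr ?_ fun M _ => rfl
    ext M
    simp [matchingsAvoiding]
  have h2 : ∑ M ∈ G.matchings, G.gibbs lam M = 1 := by
    simp only [gibbs]
    rw [← Finset.sum_div]
    exact div_self hZ.ne'
  have h3 : ∑ M ∈ G.matchings, (n : ℝ) * G.gibbs lam M = 2 * G.expectedMatchingSize lam +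
      ∑ v, G.marginal lam v [] := by
    rw [Finset.sum_congr rfl fun v _ => h1 v, Finset.sum_comm, expectedMatchingSize,
      Finset.mul_sum, ← Finset.sum_add_distrib]
    refine Finset.sum_congr rfl fun M hM => ?_
    have hM' : G.IsMatching M := by simpa [matchings] using hM
    rw [← Finset.sum_mul, ← mul_assoc, ← add_mul]
    congr 1
    exact_mod_cast (G.two_mul_card_add_card_unmatched hM').symm
  rw [← Finset.mul_sum, h2] at h3
  linarith

end OracleGraph

/-- The values computed at odd and even depths bound the marginal from below and from above. -/
theorem dfs_output_sandwich {n : ℕ} (G : OracleGraph n) {lam : ℝ} (hlam : 0 < lam) (k : ℕ)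
    (s : Fin n) (P : List (Fin n)) (hs : s ∉ P) :
    G.marginal lam s P ≤ (dfs lam (2 * k) s P).output G ∧
      (dfs lam (2 * k + 1) s P).output G ≤ G.marginal lam s P := by
  -- The recursion map reverses inequalities, so upper bounds for the children become lower bounds
  -- for the parent, and conversely.
  have step : ∀ (x y : Fin n → List (Fin n) → ℝ), (∀ t Q, 0 < x t Q) →
      (∀ t Q, t ∉ Q → x t Q ≤ y t Q) → ∀ t Q,
      1 / (1 + lam * ∑ e ∈ G.childEdges t Q, y (G.other t e) (t :: Q)) ≤
      1 / (1 + lam * ∑ e ∈ G.childEdges t Q, x (G.other t e) (t :: Q)) := by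
    intro x y hx hxy t Q
    have h0 := Finset.sum_nonneg fun e (_ : e ∈ G.childEdges t Q) =>
      (hx (G.other t e) (t :: Q)).le
    have h1 : ∑ e ∈ G.childEdges t Q, x (G.other t e) (t :: Q) ≤
        ∑ e ∈ G.childEdges t Q, y (G.other t e) (t :: Q) := by
      refine Finset.sum_le_sum fun e he => hxy _ _ ?_
      simp only [OracleGraph.childEdges, Finset.mem_filter] at he
      exact he.2.2
    apply one_div_le_one_div_of_le
    · positivity
    · gcongr
  have odd : ∀ k, (∀ t Q, t ∉ Q → G.marginal lam t Q ≤ (dfs lam (2 * k) t Q).output G) →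
      ∀ t Q, t ∉ Q → (dfs lam (2 * k + 1) t Q).output G ≤ G.marginal lam t Q := by
    intro k h t Q ht
    rw [G.marginal_rec lam hlam t Q ht, dfs_output_rec]
    exact step (G.marginal lam) (fun t Q => (dfs lam (2 * k) t Q).output G)
      (G.marginal_pos lam hlam) h t Q
  have even : ∀ k t Q, t ∉ Q → G.marginal lam t Q ≤ (dfs lam (2 * k) t Q).output G := by
    intro k
    induction k with
    | zero =>
        intro t Q ht
        rw [Nat.mul_zero, dfs_output_zero]
        exact G.marginal_le_one lam hlam t Q ht
    | succ k ih =>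
        intro t Q ht
        rw [G.marginal_rec lam hlam t Q ht, Nat.mul_succ, dfs_output_rec]
        exact step (fun t Q => (dfs lam (2 * k + 1) t Q).output G) (G.marginal lam)
          (fun t Q => dfs_output_pos G lam hlam.le _ t Q) (odd k ih) t Q
  exact ⟨even k s P hs, odd k (even k) s P hs⟩

/-- The marginal lies between the values computed at two consecutive depths. -/
theorem abs_dfs_output_sub_marginal_le {n : ℕ} (G : OracleGraph n) {lam : ℝ} (hlam : 0 < lam)
    (k : ℕ) (v : Fin n) :
    |(dfs lam (k + 1) v []).output G - G.marginal lam v []| ≤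
      |Real.log ((dfs lam (k + 1) v []).output G) - Real.log ((dfs lam k v []).output G)| := by
  -- The logarithm has slope at least `1` on `(0, 1]`, so a logarithmic gap dominates the gap
  -- itself. The marginal plays the role of `y`, between consecutive truncations.
  have key : ∀ x y z : ℝ, 0 < x → x ≤ y → y ≤ z → z ≤ 1 →
      z - x ≤ Real.log z - Real.log x := by
    intro x y z hx hxy hyz hz
    have hz0 : 0 < z := by linarith
    have h := Real.add_one_le_exp (Real.log x - Real.log z)
    rw [Real.exp_sub, Real.exp_log hx, Real.exp_log hz0, le_div_iff₀ hz0] at h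
    have hle := Real.log_le_log hx (hxy.trans hyz)
    nlinarith
  have hm := G.marginal_pos lam hlam v []
  have hp := fun k => dfs_output_pos G lam hlam.le k v []
  have h1 := fun k => dfs_output_le_one G lam hlam.le k v []
  rcases Nat.even_or_odd' k with ⟨j, rfl | rfl⟩
  · obtain ⟨ha, hb⟩ := dfs_output_sandwich G hlam j v [] (by simp)
    have := key _ _ _ (hp (2 * j + 1)) hb ha (h1 _)
    rw [abs_sub_comm (Real.log _), abs_sub_comm]
    refine le_trans ?_ (this.trans (le_abs_self _))
    rw [abs_of_nonneg (by linarith)]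
    linarith
  · obtain ⟨_, hb⟩ := dfs_output_sandwich G hlam j v [] (by simp)
    obtain ⟨ha, _⟩ := dfs_output_sandwich G hlam (j + 1) v [] (by simp)
    have := key _ _ _ (hp (2 * j + 1)) hb ha (h1 _)
    refine le_trans ?_ (this.trans (le_abs_self _))
    rw [abs_of_nonneg (by simpa [mul_add] using ha)]
    have e : 2 * j + 1 + 1 = 2 * (j + 1) := by ring
    rw [e]
    linarith

/-! ### Decay of correlations -/

/-- The source of the exponent `√Δ`. The quotient of the two sums is the contraction rate of two
levels of the recursion when the children have values `u i`; its maximum balances the factors `u i`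
and `1 - u i`. By Cauchy–Schwarz the worst case has all `u i` equal. -/
theorem sub_sum_sq_le {ι : Type*} (I : Finset ι) {lam : ℝ} {Δ : ℕ} (hlam : 0 < lam) (hΔ : 1 ≤ Δ)
    (hI : I.card ≤ Δ) (u : ι → ℝ) :
    lam * ∑ i ∈ I, u i * (1 - u i) ≤
      (1 - 2 / (√(1 + lam * Δ) + 1)) * (1 + lam * ∑ i ∈ I, u i) := by
  have hΔ' : (1 : ℝ) ≤ Δ := by exact_mod_cast hΔ
  set r := √(1 + lam * Δ) with hr
  have hr2 : r ^ 2 = 1 + lam * Δ := Real.sq_sqrt (by positivity)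
  have hr1 : 0 ≤ r := Real.sqrt_nonneg _
  have hcs : (∑ i ∈ I, u i) ^ 2 ≤ Δ * ∑ i ∈ I, u i ^ 2 :=
    (sq_sum_le_card_mul_sum_sq).trans (by
      have : 0 ≤ ∑ i ∈ I, u i ^ 2 := Finset.sum_nonneg fun _ _ => sq_nonneg _
      gcongr)
  have hexp : ∑ i ∈ I, u i * (1 - u i) = ∑ i ∈ I, u i - ∑ i ∈ I, u i ^ 2 := by
    rw [← Finset.sum_sub_distrib]
    exact Finset.sum_congr rfl fun i _ => by ring
  rw [hexp]
  set S := ∑ i ∈ I, u i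
  set Q := ∑ i ∈ I, u i ^ 2
  have hlΔ : 0 < lam * Δ := by positivity
  have hr3 : (1 - 2 / (r + 1)) * (lam * Δ) = (r - 1) ^ 2 := by
    have h : lam * Δ = r ^ 2 - 1 := by linarith
    rw [h]
    field_simp
    ring
  have h1 : lam * (S - Q) * (lam * Δ) ≤ (1 - 2 / (r + 1)) * (1 + lam * S) * (lam * Δ) := by
    have e : (1 - 2 / (r + 1)) * (1 + lam * S) * (lam * Δ) = (r - 1) ^ 2 * (1 + lam * S) := by
      rw [← hr3]; ring
    rw [e]
    have h2 : lam ^ 2 * S ^ 2 ≤ lam ^ 2 * (Δ * Q) := by gcongr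
    have h3 : lam * (S - Q) * (lam * Δ) = lam * S * (r ^ 2 - 1) - lam ^ 2 * (Δ * Q) := by
      rw [hr2]; ring
    rw [h3]
    -- After multiplication by `lam * Δ` and Cauchy–Schwarz, the difference of the two sides is
    -- exactly this square; the extremal case is `lam * S = r - 1`.
    nlinarith [sq_nonneg (lam * S - (r - 1))]
  exact le_of_mul_le_mul_right h1 hlΔ

/-- Two levels of the recursion contract distances on the logarithmic scale. -/
theorem abs_log_two_step_le {ι κ : Type*} (I : Finset ι) (J : ι → Finset κ) {lam δ : ℝ} {Δ : ℕ}
    (hlam : 0 < lam) (hΔ : 1 ≤ Δ) (hI : I.card ≤ Δ) (x y : ι → κ → ℝ)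
    (hx : ∀ i j, 0 < x i j) (hy : ∀ i j, 0 < y i j) (hδ : 0 ≤ δ)
    (h : ∀ i ∈ I, ∀ j ∈ J i, |Real.log (x i j) - Real.log (y i j)| ≤ δ) :
    |Real.log (1 / (1 + lam * ∑ i ∈ I, 1 / (1 + lam * ∑ j ∈ J i, x i j))) -
        Real.log (1 / (1 + lam * ∑ i ∈ I, 1 / (1 + lam * ∑ j ∈ J i, y i j)))| ≤
      (1 - 2 / (√(1 + lam * Δ) + 1)) * δ := by
  have hsub := sub_sum_sq_le I hlam hΔ hI
  generalize 1 - 2 / (√(1 + lam * Δ) + 1) = q at hsub ⊢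
  -- The grandchildren are interpolated linearly in logarithmic coordinates, from `y` at `t = 0` to
  -- `x` at `t = 1`. Then `g` is minus the logarithm of the root value, and the mean value
  -- inequality reduces the claim to a bound on `g'`.
  let d : ι → κ → ℝ := fun i j => Real.log (x i j) - Real.log (y i j)
  let z : ι → κ → ℝ → ℝ := fun i j t => Real.log (y i j) + t * d i j
  let w : ι → ℝ → ℝ := fun i t => 1 + lam * ∑ j ∈ J i, Real.exp (z i j t)
  let u : ι → ℝ → ℝ := fun i t => (w i t)⁻¹
  let g : ℝ → ℝ := fun t => Real.log (1 + lam * ∑ i ∈ I, u i t)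
  have hw : ∀ i t, 1 ≤ w i t := fun i t =>
    le_add_of_nonneg_right (mul_nonneg hlam.le (Finset.sum_nonneg fun j _ => (Real.exp_pos _).le))
  have hu : ∀ i t, 0 < u i t := fun i t => inv_pos.2 (by linarith [hw i t])
  have hv : ∀ t, 1 ≤ 1 + lam * ∑ i ∈ I, u i t := fun t =>
    le_add_of_nonneg_right (mul_nonneg hlam.le (Finset.sum_nonneg fun i _ => (hu i t).le))
  have dz : ∀ i j t, HasDerivAt (z i j) (d i j) t := fun i j t => by
    have := ((hasDerivAt_id t).mul_const (d i j)).const_add (Real.log (y i j))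
    rwa [one_mul] at this
  have dw : ∀ i t, HasDerivAt (w i) (lam * ∑ j ∈ J i, Real.exp (z i j t) * d i j) t := fun i t =>
    ((HasDerivAt.fun_sum fun j _ => (dz i j t).exp).const_mul lam).const_add 1
  have du : ∀ i t, HasDerivAt (u i)
      (-(lam * ∑ j ∈ J i, Real.exp (z i j t) * d i j) / w i t ^ 2) t := fun i t =>
    (dw i t).fun_inv (by linarith [hw i t])
  have dg : ∀ t, HasDerivAt g ((lam * ∑ i ∈ I,
      -(lam * ∑ j ∈ J i, Real.exp (z i j t) * d i j) / w i t ^ 2) /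
        (1 + lam * ∑ i ∈ I, u i t)) t := fun t =>
    (((HasDerivAt.fun_sum fun i _ => du i t).const_mul lam).const_add 1).log (by linarith [hv t])
  have bound : ∀ t, ‖(lam * ∑ i ∈ I, -(lam * ∑ j ∈ J i, Real.exp (z i j t) * d i j) / w i t ^ 2) /
        (1 + lam * ∑ i ∈ I, u i t)‖ ≤ q * δ := by
    intro t
    rw [Real.norm_eq_abs, abs_div, abs_of_pos (by linarith [hv t] : 0 < 1 + lam * ∑ i ∈ I, u i t),
      div_le_iff₀ (by linarith [hv t]), abs_mul, abs_of_pos hlam]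
    -- The sum inside `w i` moves at a rate of at most `δ * (w i t - 1)`. Dividing by `w i t ^ 2`
    -- and substituting `w = 1 / u` produces the weight `u * (1 - u)`.
    have hi : ∀ i ∈ I, |-(lam * ∑ j ∈ J i, Real.exp (z i j t) * d i j) / w i t ^ 2| ≤
        δ * (u i t * (1 - u i t)) := by
      intro i hi
      have hw0 : 0 < w i t := by linarith [hw i t]
      rw [abs_div, abs_neg, abs_mul, abs_of_pos hlam, abs_of_pos (pow_pos hw0 2),
        div_le_iff₀ (pow_pos hw0 2)]
      have e : δ * (u i t * (1 - u i t)) * w i t ^ 2 = δ * (w i t - 1) := by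
        simp only [u]
        field_simp
      rw [e]
      have e2 : δ * (w i t - 1) = lam * ∑ j ∈ J i, Real.exp (z i j t) * δ := by
        simp only [w]
        rw [← Finset.sum_mul]
        ring
      rw [e2]
      gcongr
      refine (Finset.abs_sum_le_sum_abs _ _).trans (Finset.sum_le_sum fun j hj => ?_)
      rw [abs_mul, abs_of_pos (Real.exp_pos _)]
      gcongr
      exact h i hi j hj
    calc lam * |∑ i ∈ I, -(lam * ∑ j ∈ J i, Real.exp (z i j t) * d i j) / w i t ^ 2|
        ≤ lam * ∑ i ∈ I, δ * (u i t * (1 - u i t)) := by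
          gcongr
          exact (Finset.abs_sum_le_sum_abs _ _).trans (Finset.sum_le_sum hi)
      _ = δ * (lam * ∑ i ∈ I, u i t * (1 - u i t)) := by rw [← Finset.mul_sum]; ring
      _ ≤ δ * (q * (1 + lam * ∑ i ∈ I, u i t)) := by
          exact mul_le_mul_of_nonneg_left (hsub fun i => u i t) hδ
      _ = q * δ * (1 + lam * ∑ i ∈ I, u i t) := by ring
  have main := Convex.norm_image_sub_le_of_norm_hasDerivWithin_le (f := g) (s := Set.univ)
    (fun t _ => (dg t).hasDerivWithinAt) (fun t _ => bound t) convex_univ (Set.mem_univ 0)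
    (Set.mem_univ 1)
  have e0 : ∀ i, u i 0 = 1 / (1 + lam * ∑ j ∈ J i, y i j) := by
    intro i
    simp only [u, w, z, zero_mul, add_zero, Real.exp_log (hy i _), one_div]
  have e1 : ∀ i, u i 1 = 1 / (1 + lam * ∑ j ∈ J i, x i j) := by
    intro i
    simp only [u, w, z, d, one_mul, add_sub_cancel, Real.exp_log (hx i _), one_div]
  simp only [g, e0, e1, Real.norm_eq_abs, sub_zero, abs_one, mul_one] at main
  rw [one_div, Real.log_inv, one_div, Real.log_inv, neg_sub_neg, abs_sub_comm]
  exact main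

section Decay

variable {n : ℕ} (G : OracleGraph n) {lam : ℝ} {Δ : ℕ}

theorem neg_log_dfs_output_le (hlam : 0 < lam) (hG : G.MaxDegreeLE Δ) (k : ℕ) (s : Fin n)
    (path : List (Fin n)) : -Real.log ((dfs lam k s path).output G) ≤ lam * Δ := by
  cases k with
  | zero => rw [dfs_output_zero]; simp; positivity
  | succ k =>
      rw [dfs_output_rec, one_div, Real.log_inv, neg_neg]
      have h0 := Finset.sum_nonneg fun e (_ : e ∈ G.childEdges s path) =>
        (dfs_output_pos G lam hlam.le k (G.other s e) (s :: path)).le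
      have h1 : ∑ e ∈ G.childEdges s path, (dfs lam k (G.other s e) (s :: path)).output G ≤ Δ := by
        refine (Finset.sum_le_card_nsmul _ _ 1 fun e _ =>
          dfs_output_le_one G lam hlam.le k _ _).trans ?_
        rw [nsmul_eq_mul, mul_one]
        exact_mod_cast (G.card_childEdges_le s path).trans (hG s)
      refine (Real.log_le_sub_one_of_pos (by positivity)).trans ?_
      rw [add_sub_cancel_left]
      gcongr

/-- All logarithms lie in `[-lam * Δ, 0]`, which starts the induction at `j = 0`. Each further pair
of levels contributes one contraction factor. -/
theorem abs_log_dfs_output_sub_le (hlam : 0 < lam) (hΔ : 1 ≤ Δ) (hG : G.MaxDegreeLE Δ) (j : ℕ) :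
    ∀ k, 2 * j ≤ k → ∀ (s : Fin n) (path : List (Fin n)),
    |Real.log ((dfs lam (k + 1) s path).output G) - Real.log ((dfs lam k s path).output G)| ≤
      (1 - 2 / (√(1 + lam * Δ) + 1)) ^ j * (lam * Δ) := by
  have hq : 0 ≤ 1 - 2 / (√(1 + lam * Δ) + 1) := by
    have h1 : 1 ≤ √(1 + lam * Δ) := Real.one_le_sqrt.2 (by
      have : 0 ≤ lam * Δ := by positivity
      linarith)
    rw [sub_nonneg, div_le_one (by linarith)]
    linarith
  have hrec := dfs_output_rec G lam
  have hpos := dfs_output_pos G lam hlam.le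
  have hone := dfs_output_le_one G lam hlam.le
  have hlog := neg_log_dfs_output_le G hlam hG
  generalize hD : (fun k s path => (dfs lam k s path).output G) = D
  have hD' : ∀ k s path, (dfs lam k s path).output G = D k s path := fun k s path =>
    congrFun (congrFun (congrFun hD k) s) path
  simp only [hD'] at hrec hpos hone hlog ⊢
  induction j with
  | zero =>
      intro k _ s path
      rw [pow_zero, one_mul, abs_le]
      have h1 := hlog (k + 1) s path
      have h2 := hlog k s path
      have h3 := Real.log_nonpos (hpos (k + 1) s path).le (hone (k + 1) s path)
      have h4 := Real.log_nonpos (hpos k s path).le (hone k s path)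
      constructor <;> linarith
  | succ j ih =>
      intro k hk s path
      obtain ⟨k, rfl⟩ : ∃ l, k = l + 2 := ⟨k - 2, by omega⟩
      rw [pow_succ', mul_assoc]
      have hδ : 0 ≤ (1 - 2 / (√(1 + lam * Δ) + 1)) ^ j * (lam * Δ) := by positivity
      have key := abs_log_two_step_le (G.childEdges s path)
        (fun e => G.childEdges (G.other s e) (s :: path)) hlam hΔ
        ((G.card_childEdges_le s path).trans (hG s))
        (fun e f => D (k + 1) (G.other (G.other s e) f) (G.other s e :: s :: path))
        (fun e f => D k (G.other (G.other s e) f) (G.other s e :: s :: path))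
        (fun e f => hpos _ _ _) (fun e f => hpos _ _ _) hδ
        (fun e _ f _ => ih k (by omega) _ _)
      simpa only [← hrec] using key

end Decay

/-! ### Query complexity of the algorithm -/

section Complexity

variable {n : ℕ} (G : OracleGraph n) {lam : ℝ} {Δ : ℕ}

/-- The costs of successive depths form a geometric series. The term `3 * Δ ^ (h + 2)` on the left
pays for the next search, since `2 * Δ ^ (h + 2) ≤ Δ ^ (h + 3)`. Note that `dfs lam h` computes `x[h
+ 1]`. -/
theorem approxMarginalLoop_queries_le (hΔ : 2 ≤ Δ) (hG : G.MaxDegreeLE Δ) (ε : ℝ) (v : Fin n)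
    (N : ℕ) (hN : |Real.log ((dfs lam (N + 1) v []).output G) -
      Real.log ((dfs lam N v []).output G)| ≤ ε / Real.exp 1)
    (fuel h : ℕ) (h2 : h ≤ N) (xp xc : ℝ)
    (hp : xp = (dfs lam h v []).output G) (hc : xc = (dfs lam (h + 1) v []).output G) :
    (approxMarginalLoop lam ε v fuel (h + 2) xp xc).queries G + 3 * Δ ^ (h + 2) ≤
      3 * Δ ^ (N + 2) := by
  have hmono : 3 * Δ ^ (h + 2) ≤ 3 * Δ ^ (N + 2) :=
    Nat.mul_le_mul_left _ (Nat.pow_le_pow_right (by omega) (by omega))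
  induction fuel generalizing h xp xc with
  | zero =>
      rw [approxMarginalLoop]
      change 0 + _ ≤ _
      omega
  | succ fuel ih =>
      rw [approxMarginalLoop]
      split_ifs with hcond
      · have hlt : h < N := by
          refine lt_of_le_of_ne h2 fun he => ?_
          subst he
          rw [hp, hc] at hcond
          exact absurd hN (not_le.2 hcond)
        rw [QueryProg.queries_bind]
        have h3 := ih (h + 1) hlt xc ((dfs lam (h + 2) v []).output G) hc rfl
          (Nat.mul_le_mul_left _ (Nat.pow_le_pow_right (by omega) (by omega)))
        have h4 := dfs_queries_le G lam hΔ hG (h + 2) v []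
        have h5 : 2 * Δ ^ (h + 2) ≤ Δ ^ (h + 1 + 2) := by
          rw [show h + 1 + 2 = h + 2 + 1 by ring, pow_succ' Δ (h + 2)]
          exact Nat.mul_le_mul_right _ hΔ
        change _ + (approxMarginalLoop lam ε v fuel (h + 1 + 2) xc _).queries G + _ ≤ _
        omega
      · change 0 + _ ≤ _
        omega

theorem approxMarginal_queries_le (hΔ : 2 ≤ Δ) (hG : G.MaxDegreeLE Δ) (ε : ℝ) (v : Fin n)
    (N : ℕ) (hN : |Real.log ((dfs lam (N + 1) v []).output G) -
      Real.log ((dfs lam N v []).output G)| ≤ ε / Real.exp 1) :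
    (approxMarginal lam ε v).queries G ≤ 3 * Δ ^ (N + 2) := by
  rw [approxMarginal]
  simp only [QueryProg.queries_bind]
  have h0 := dfs_queries_le G lam hΔ hG 0 v []
  have h1 := dfs_queries_le G lam hΔ hG 1 v []
  have h2 := approxMarginalLoop_queries_le G hΔ hG ε v N hN n 0 (Nat.zero_le N) _ _ rfl rfl
  rw [pow_zero] at h0
  rw [pow_one] at h1
  simp only [Nat.zero_add] at h2
  have h3 : Δ ≤ Δ ^ 2 := Nat.le_self_pow (by norm_num) Δ
  omega

theorem matchingStatisticsProg_queries_le {ε : ℝ} {s c : ℕ} (U : Fin s → Fin n)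
    (h : ∀ v, (approxMarginal lam (ε / 2) v).queries G ≤ c) :
    (matchingStatisticsProg lam ε U).queries G ≤ s * c := by
  rw [matchingStatisticsProg, QueryProg.queries_bind]
  change _ + 0 ≤ _
  rw [add_zero]
  refine (QueryProg.queries_foldlM_le G _ c (fun a u => ?_) (List.ofFn U) 0).trans ?_
  · rw [QueryProg.queries_bind]
    change _ + 0 ≤ _
    exact h u
  · rw [List.length_ofFn]

/-- A depth at which the loop of `Approx-Marginal` has stopped. -/
theorem exists_depth (hlam : 0 < lam) :
    ∃ c : ℝ, 0 < c ∧ ∀ (Δ : ℕ), 2 ≤ Δ → ∀ ε : ℝ, 0 < ε → ε ≤ 1 / 2 → ∃ N : ℕ,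
      ((N + 2 : ℕ) : ℝ) ≤ c * (√(Δ : ℝ) * Real.log Δ * Real.log (1 / ε)) ∧
      ∀ (n : ℕ) (G : OracleGraph n), G.MaxDegreeLE Δ → ∀ v,
        |Real.log ((dfs lam (N + 1) v []).output G) - Real.log ((dfs lam N v []).output G)| ≤
          ε / 2 / Real.exp 1 := by
  -- Both logarithms are at least `1/2`, so constants and single logarithms are absorbed into the
  -- product `log Δ * log (1 / ε)`; this gives `L ≤ c₁ * (log Δ * log (1 / ε))` below.
  set c₁ : ℝ := 4 * (Real.log (1 + lam) + 2) + 4 with hc₁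
  have hl0 : 0 ≤ Real.log (1 + lam) := Real.log_nonneg (by linarith)
  refine ⟨2 * (1 + lam) * c₁ + 16, by positivity, fun Δ hΔ ε hε hε2 => ?_⟩
  have hΔ' : (2 : ℝ) ≤ Δ := by exact_mod_cast hΔ
  set r := √(1 + lam * Δ) with hr
  -- Chosen so that `exp (-L) * ((1 + lam) * Δ) = ε / exp 2`, which is below the threshold `ε / (2
  -- e)`. Since `q ≤ exp (-2 / (r + 1))` for the contraction factor `q`, taking `j ≥ (r + 1) / 2 *
  -- L` double levels gives `q ^ j ≤ exp (-L)`.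
  set L := Real.log (1 + lam) + Real.log Δ + Real.log (1 / ε) + 2 with hL
  have hlog2 : 1 / 2 ≤ Real.log 2 := by linarith [Real.log_two_gt_d9]
  have hLΔ : 1 / 2 ≤ Real.log Δ := hlog2.trans (Real.log_le_log (by norm_num) hΔ')
  have hLε : 1 / 2 ≤ Real.log (1 / ε) := hlog2.trans (Real.log_le_log (by norm_num)
    (by rw [le_div_iff₀ hε]; linarith))
  have hr0 : 0 ≤ r := Real.sqrt_nonneg _
  have hL0 : 0 ≤ L := by linarith
  set j := ⌈(r + 1) / 2 * L⌉₊ with hj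
  have hjL : (r + 1) / 2 * L ≤ j := Nat.le_ceil _
  have hju : (j : ℝ) < (r + 1) / 2 * L + 1 := Nat.ceil_lt_add_one (by positivity)
  have hsq : 1 ≤ √(Δ : ℝ) := Real.one_le_sqrt.2 (by linarith)
  refine ⟨2 * j, ?_, fun n G hG v => ?_⟩
  · have hrle : (r + 1) / 2 ≤ (1 + lam) * √(Δ : ℝ) := by
      have : r ≤ (1 + lam) * √(Δ : ℝ) := by
        rw [hr, Real.sqrt_le_left (by positivity), mul_pow, Real.sq_sqrt (by positivity)]
        nlinarith [mul_pos hlam hlam, mul_nonneg hlam.le (by linarith : (0 : ℝ) ≤ Δ - 2),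
          mul_nonneg (mul_pos hlam hlam).le (by linarith : (0 : ℝ) ≤ Δ - 2)]
      nlinarith
    have hLle : L ≤ c₁ * (Real.log Δ * Real.log (1 / ε)) := by
      set a := Real.log Δ
      set b := Real.log (1 / ε)
      have h1 : 1 / 4 ≤ a * b := by nlinarith
      have h2 : a ≤ 2 * (a * b) := by nlinarith
      have h3 : b ≤ 2 * (a * b) := by nlinarith
      have h4 : Real.log (1 + lam) + 2 ≤ (Real.log (1 + lam) + 2) * (4 * (a * b)) :=
        le_mul_of_one_le_right (by linarith) (by linarith)
      rw [hL, hc₁]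
      linarith
    have h1 : (r + 1) / 2 * L ≤
        (1 + lam) * √(Δ : ℝ) * (c₁ * (Real.log Δ * Real.log (1 / ε))) := by gcongr
    have h2 : 1 / 4 ≤ √(Δ : ℝ) * Real.log Δ * Real.log (1 / ε) := by
      have : 1 / 4 ≤ Real.log Δ * Real.log (1 / ε) := by nlinarith
      rw [mul_assoc]
      nlinarith
    push_cast
    linarith
  · refine (abs_log_dfs_output_sub_le G hlam (by omega) hG j (2 * j) le_rfl v []).trans ?_
    have hq0 : 1 - 2 / (r + 1) ≤ Real.exp (-(2 / (r + 1))) := Real.one_sub_le_exp_neg _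
    have hr1 : 1 ≤ r := Real.one_le_sqrt.2 (by
      have : 0 ≤ lam * Δ := by positivity
      linarith)
    have hq : 0 ≤ 1 - 2 / (r + 1) := by
      rw [sub_nonneg, div_le_one (by linarith)]
      linarith
    have h1 : (1 - 2 / (r + 1)) ^ j ≤ Real.exp (-L) := by
      refine (pow_le_pow_left₀ hq hq0 j).trans ?_
      rw [← Real.exp_nat_mul, Real.exp_le_exp, mul_neg, neg_le_neg_iff]
      have : (r + 1) / 2 * L * (2 / (r + 1)) = L := by field_simp
      rw [← this]
      gcongr
    have h2 : Real.exp (-L) = ε / ((1 + lam) * Δ * Real.exp 2) := by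
      rw [Real.exp_neg, hL, Real.exp_add, Real.exp_add, Real.exp_add, Real.exp_log (by linarith),
        Real.exp_log (by linarith), Real.exp_log (by positivity)]
      field_simp
    have h3 : 2 * Real.exp 1 ≤ Real.exp 2 := by
      have : (2 : ℝ) = 1 + 1 := by norm_num
      rw [this, Real.exp_add, ← this]
      gcongr
      linarith [Real.add_one_le_exp 1]
    calc (1 - 2 / (r + 1)) ^ j * (lam * Δ) ≤ Real.exp (-L) * ((1 + lam) * Δ) := by
          gcongr
          linarith
      _ = ε / Real.exp 2 := by rw [h2]; field_simp
      _ ≤ ε / (2 * Real.exp 1) := by gcongr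
      _ = ε / 2 / Real.exp 1 := by rw [div_div]

end Complexity

theorem exists_queries_le {C lam : ℝ} (hC : 0 < C) (hlam : 0 < lam) :
    ∃ (K : ℝ) (a : ℕ), 0 < K ∧
      ∀ (Δ : ℕ), 2 ≤ Δ → ∀ ε : ℝ, 0 < ε → ε ≤ 1 / 2 →
        ∀ (n : ℕ) [NeZero n] (G : OracleGraph n), G.MaxDegreeLE Δ →
          ∀ U, ((((approxMatchingStatistics C lam ε n).prog U).queries G : ℕ) : ℝ) ≤
            K * (1 / ε) ^ (K * √(Δ : ℝ) * Real.log Δ ^ a) := by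
  obtain ⟨c, hc, H⟩ := exists_depth hlam
  -- The exponent `2` of `log Δ` combines one factor from the depth and one from `Δ ^ depth = exp
  -- (depth * log Δ)`. In `K`, `3 * (C + 1)` covers the prefactor, `c` the depth, and `8` the sample
  -- size `1 / ε ^ 2`.
  refine ⟨3 * (C + 1) + c + 8, 2, by positivity, fun Δ hΔ ε hε hε2 n _ G hG U => ?_⟩
  obtain ⟨N, hN, hN'⟩ := H Δ hΔ ε hε hε2
  have hΔ' : (2 : ℝ) ≤ Δ := by exact_mod_cast hΔ
  have hlog2 : 1 / 2 ≤ Real.log 2 := by linarith [Real.log_two_gt_d9]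
  have hLΔ : 1 / 2 ≤ Real.log Δ := hlog2.trans (Real.log_le_log (by norm_num) hΔ')
  have hLε : 1 / 2 ≤ Real.log (1 / ε) := hlog2.trans (Real.log_le_log (by norm_num)
    (by rw [le_div_iff₀ hε]; linarith))
  have hsq : 1 ≤ √(Δ : ℝ) := Real.one_le_sqrt.2 (by linarith)
  have hε1 : ε ^ 2 ≤ 1 := pow_le_one₀ hε.le (by linarith)
  have h1 : (((approxMatchingStatistics C lam ε n).prog U).queries G : ℕ) ≤
      ⌈C / ε ^ 2⌉₊ * (3 * Δ ^ (N + 2)) :=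
    matchingStatisticsProg_queries_le G (s := ⌈C / ε ^ 2⌉₊) U fun v =>
      approxMarginal_queries_le G hΔ hG (ε / 2) v N (hN' n G hG v)
  have h2 : ((⌈C / ε ^ 2⌉₊ : ℕ) : ℝ) ≤ (C + 1) * Real.exp (2 * Real.log (1 / ε)) := by
    have e : Real.exp (2 * Real.log (1 / ε)) = 1 / ε ^ 2 := by
      rw [mul_comm, Real.exp_mul, Real.exp_log (by positivity)]
      norm_num
    have h3 : 1 ≤ 1 / ε ^ 2 := by rw [le_div_iff₀ (by positivity)]; linarith
    rw [e, add_mul, one_mul, mul_one_div]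
    exact (Nat.ceil_lt_add_one (by positivity)).le.trans (by linarith)
  have h3 : ((Δ : ℝ)) ^ (N + 2) ≤
      Real.exp (c * (√(Δ : ℝ) * Real.log Δ * Real.log (1 / ε)) * Real.log Δ) := by
    rw [← Real.rpow_natCast, Real.rpow_def_of_pos (by linarith), Real.exp_le_exp, mul_comm]
    gcongr
  have h4 : (1 / ε) ^ ((3 * (C + 1) + c + 8) * √(Δ : ℝ) * Real.log Δ ^ 2) =
      Real.exp (Real.log (1 / ε) * ((3 * (C + 1) + c + 8) * √(Δ : ℝ) * Real.log Δ ^ 2)) :=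
    Real.rpow_def_of_pos (by positivity) _
  rw [h4]
  set a := Real.log Δ
  set b := Real.log (1 / ε)
  set r := √(Δ : ℝ)
  have h5 : 2 * b + c * (r * a * b) * a ≤ b * ((3 * (C + 1) + c + 8) * r * a ^ 2) := by
    have h6 : 1 / 4 ≤ r * a ^ 2 := by nlinarith
    have h7 : 2 * b ≤ b * (8 * r * a ^ 2) := by nlinarith
    have h8 : 0 ≤ b * (3 * (C + 1) * r * a ^ 2) := by positivity
    nlinarith
  calc ((((approxMatchingStatistics C lam ε n).prog U).queries G : ℕ) : ℝ)
      ≤ (⌈C / ε ^ 2⌉₊ : ℕ) * (3 * (Δ : ℝ) ^ (N + 2)) := by exact_mod_cast h1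
    _ ≤ (C + 1) * Real.exp (2 * b) * (3 * Real.exp (c * (r * a * b) * a)) := by gcongr
    _ = 3 * (C + 1) * Real.exp (2 * b + c * (r * a * b) * a) := by rw [Real.exp_add]; ring
    _ ≤ (3 * (C + 1) + c + 8) *
        Real.exp (b * ((3 * (C + 1) + c + 8) * r * a ^ 2)) := by
      gcongr
      linarith

/-! ### Correctness of the algorithm -/

section Correctness

variable {n : ℕ} (G : OracleGraph n) {lam : ℝ}

theorem approxMarginalLoop_output {ε : ℝ} (hε : 0 < ε) (v : Fin n) (fuel h : ℕ)
    (hh : n ≤ fuel + h) (xp xc : ℝ) (hp : xp = (dfs lam h v []).output G)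
    (hc : xc = (dfs lam (h + 1) v []).output G) :
    ∃ k, (approxMarginalLoop lam ε v fuel (h + 2) xp xc).output G =
        (dfs lam (k + 1) v []).output G ∧
      |Real.log ((dfs lam (k + 1) v []).output G) - Real.log ((dfs lam k v []).output G)| ≤
        ε / Real.exp 1 := by
  induction fuel generalizing h xp xc with
  | zero =>
      -- When the fuel is exhausted, `h ≥ n`: the search is no longer truncated, consecutive values
      -- agree, and the stopping test holds anyway.
      refine ⟨h, hc, ?_⟩
      rw [dfs_output_succ G lam h v [] (by simp) (by simp; omega), sub_self, abs_zero]
      positivity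
  | succ fuel ih =>
      rw [approxMarginalLoop]
      split_ifs with hcond
      · rw [QueryProg.output_bind]
        exact ih (h + 1) (by omega) _ _ hc rfl
      · refine ⟨h, hc, ?_⟩
        rw [← hp, ← hc]
        exact not_lt.1 hcond

theorem approxMarginal_output (hlam : 0 < lam) {ε : ℝ} (hε : 0 < ε) (v : Fin n) :
    (approxMarginal lam ε v).output G ∈ Set.Icc 0 1 ∧
      |(approxMarginal lam ε v).output G - G.marginal lam v []| ≤ ε / Real.exp 1 := by
  have h : (approxMarginal lam ε v).output G = (approxMarginalLoop lam ε v n 2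
      ((dfs lam 0 v []).output G) ((dfs lam 1 v []).output G)).output G := by
    rw [approxMarginal]
    simp only [QueryProg.output_bind]
  obtain ⟨k, hk, hk'⟩ := approxMarginalLoop_output G (lam := lam) hε v n 0 (by omega) _ _ rfl rfl
  rw [h, hk]
  exact ⟨⟨(dfs_output_pos G lam hlam.le _ v []).le, dfs_output_le_one G lam hlam.le _ v []⟩,
    (abs_dfs_output_sub_marginal_le G hlam k v).trans hk'⟩

theorem matchingStatisticsProg_output (ε : ℝ) {s : ℕ} (U : Fin s → Fin n) :
    (matchingStatisticsProg lam ε U).output G =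
      (n : ℝ) / 2 - (n : ℝ) / (2 * s) * ∑ i, (approxMarginal lam (ε / 2) (U i)).output G := by
  rw [matchingStatisticsProg, QueryProg.output_bind,
    QueryProg.output_foldlM_add G _ (fun u => (approxMarginal lam (ε / 2) u).output G),
    List.map_ofFn, List.sum_ofFn, zero_add]
  · rfl
  · intro a u
    rw [QueryProg.output_bind]
    rfl

end Correctness

instance isProbabilityMeasure_uniformOn_fin (n : ℕ) [NeZero n] :
    IsProbabilityMeasure (uniformOn (Set.univ : Set (Fin n))) :=
  isProbabilityMeasure_uniformOn Set.finite_univ Set.univ_nonempty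

theorem integral_uniformOn_fin {n : ℕ} [NeZero n] (f : Fin n → ℝ) :
    ∫ v, f v ∂(uniformOn (Set.univ : Set (Fin n))) = (∑ v, f v) / n := by
  rw [integral_fintype (Integrable.of_finite), Finset.sum_div]
  refine Finset.sum_congr rfl fun v _ => ?_
  rw [Measure.real, uniformOn_univ, Measure.count_singleton, Fintype.card_fin]
  simp [div_eq_inv_mul]

/-- Chebyshev's inequality for the sum over a uniform sample. -/
theorem measure_sample_sum_le {n s : ℕ} [NeZero n] (f : Fin n → ℝ)
    (hf : ∀ v, f v ∈ Set.Icc (0 : ℝ) 1) {t : ℝ} (ht : 0 < t) :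
    Measure.pi (fun _ : Fin s => uniformOn (Set.univ : Set (Fin n)))
      {U | t ≤ |∑ i, f (U i) - s * ((∑ v, f v) / n)|} ≤ ENNReal.ofReal (s / 4 / t ^ 2) := by
  have hL : ∀ i : Fin s, MemLp ((fun _ : Fin s => f) i) 2 (uniformOn (Set.univ : Set (Fin n))) :=
    fun _ => MemLp.of_discrete
  have hvar := variance_sum_pi hL
  have hX : (∑ i : Fin s, fun ω : Fin s → Fin n => f (ω i)) = fun ω => ∑ i, f (ω i) := by
    ext ω
    simp
  rw [hX] at hvar
  have hmean : ∫ ω, ∑ i, f (ω i) ∂(Measure.pi fun _ : Fin s =>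
      uniformOn (Set.univ : Set (Fin n))) = s * ((∑ v, f v) / n) := by
    rw [integral_finsetSum _ fun i _ => Integrable.of_finite]
    have : ∀ i : Fin s, ∫ ω : Fin s → Fin n, f (ω i) ∂(Measure.pi fun _ : Fin s =>
        uniformOn (Set.univ : Set (Fin n))) = (∑ v, f v) / n := fun i => by
      rw [← integral_uniformOn_fin]
      exact integral_comp_eval (μ := fun _ : Fin s => uniformOn (Set.univ : Set (Fin n)))
        (Measurable.of_discrete.aestronglyMeasurable)
    simp [this]
  have hcheb := meas_ge_le_variance_div_sq (μ := Measure.pi fun _ : Fin s =>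
    uniformOn (Set.univ : Set (Fin n))) (X := fun ω => ∑ i, f (ω i)) MemLp.of_discrete ht
  rw [hmean, hvar] at hcheb
  refine hcheb.trans (ENNReal.ofReal_le_ofReal ?_)
  gcongr
  -- A random variable with values in `[0, 1]` has variance at most `1/4`.
  refine (Finset.sum_le_card_nsmul _ _ (((1 - 0) / 2) ^ 2) fun i _ =>
    variance_le_sq_of_bounded (Filter.Eventually.of_forall hf)
      Measurable.of_discrete.aemeasurable).trans_eq ?_
  rw [Finset.card_univ, Fintype.card_fin, nsmul_eq_mul]
  ring

/-- Chebyshev's inequality is applied to the computed values, not to the true marginals. Sampling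
and the bias of the computed values each use half of the error budget `ε * n`, and the failure
probability is at most `1 / (4 s ε ^ 2) ≤ 1 / (4 C)`. -/
theorem isApproximation_approxMatchingStatistics {p C lam : ℝ} (hC : 0 < C)
    (hCp : 1 / (4 * C) ≤ 1 - p) (hlam : 0 < lam) (n : ℕ) [NeZero n] {ε : ℝ} (hε : 0 < ε) :
    (approxMatchingStatistics C lam ε n).IsApproximation Set.univ
      (fun G => G.expectedMatchingSize lam) (ε * n) p := by
  intro G _
  set s := ⌈C / ε ^ 2⌉₊ with hs
  set f : Fin n → ℝ := fun v => (approxMarginal lam (ε / 2) v).output G with hf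
  have hs0 : 0 < s := Nat.ceil_pos.2 (by positivity)
  have hs0' : (0 : ℝ) < s := by exact_mod_cast hs0
  have hsC : C ≤ s * ε ^ 2 := by
    rw [← div_le_iff₀ (by positivity)]
    exact Nat.le_ceil _
  have hn : (0 : ℝ) < n := by exact_mod_cast Nat.pos_of_ne_zero (NeZero.ne n)
  have hmarg := fun v => approxMarginal_output G hlam (half_pos hε) v
  have hbad := measure_sample_sum_le (s := s) f (fun v => (hmarg v).1) (mul_pos hs0' hε)
  set μ := Measure.pi (fun _ : Fin s => uniformOn (Set.univ : Set (Fin n)))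
  set T := {U : Fin s → Fin n | s * ε ≤ |∑ i, f (U i) - s * ((∑ v, f v) / n)|}
  have hsub : Tᶜ ⊆ {U : Fin s → Fin n |
      |(matchingStatisticsProg lam ε U).output G - G.expectedMatchingSize lam| ≤ ε * n} := by
    intro U hU
    simp only [T, Set.mem_compl_iff, Set.mem_ofPred_eq, not_le] at hU
    rw [Set.mem_ofPred_eq, matchingStatisticsProg_output, G.expectedMatchingSize_eq lam hlam]
    have e1 : ε / 2 / Real.exp 1 ≤ ε := by
      rw [div_div]
      refine div_le_self hε.le ?_
      linarith [Real.add_one_le_exp 1]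
    have h1 : |∑ v, (f v - G.marginal lam v [])| ≤ n * ε := by
      refine (Finset.abs_sum_le_sum_abs _ _).trans
        ((Finset.sum_le_card_nsmul _ _ ε fun v _ => (hmarg v).2.trans e1).trans_eq ?_)
      rw [Finset.card_univ, Fintype.card_fin, nsmul_eq_mul]
    rw [Finset.sum_sub_distrib] at h1
    have h2 : (n : ℝ) / 2 - (n : ℝ) / (2 * s) * ∑ i, f (U i) -
        ((n : ℝ) / 2 - 1 / 2 * ∑ v, G.marginal lam v []) =
        -(n / (2 * s) * (∑ i, f (U i) - s * ((∑ v, f v) / n))) -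
          1 / 2 * (∑ v, f v - ∑ v, G.marginal lam v []) := by
      field_simp
      ring
    change |(n : ℝ) / 2 - (n : ℝ) / (2 * s) * ∑ i, f (U i) - _| ≤ _
    rw [h2]
    refine (abs_sub _ _).trans ?_
    rw [abs_neg, abs_mul, abs_mul, abs_of_pos (by positivity : (0 : ℝ) < n / (2 * s)),
      abs_of_pos (by norm_num : (0 : ℝ) < 1 / 2)]
    have h3 : n / (2 * s) * |∑ i, f (U i) - s * ((∑ v, f v) / n)| ≤ n / (2 * s) * (s * ε) := by
      gcongr
    have h4 : (n : ℝ) / (2 * s) * (s * ε) = n * ε / 2 := by field_simp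
    linarith
  have hT : μ T ≤ ENNReal.ofReal (1 - p) := by
    refine hbad.trans (ENNReal.ofReal_le_ofReal (le_trans ?_ hCp))
    rw [div_div, div_le_div_iff₀ (by positivity) (by positivity)]
    nlinarith
  have hmeas : MeasurableSet T := (Set.toFinite T).measurableSet
  change ENNReal.ofReal p ≤ μ _
  refine le_trans ?_ (measure_mono hsub)
  rw [prob_compl_eq_one_sub hmeas]
  refine le_trans ?_ (tsub_le_tsub_left hT 1)
  rw [← ENNReal.ofReal_one, ← ENNReal.ofReal_sub _ (le_trans (by positivity) hCp)]
  rw [sub_sub_cancel]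

/-! ### Random subsets -/

section CubeSum

variable {ι : Type*} [DecidableEq ι]

/-- The expectation of `f (B ∪ A)`, where `A` is a random subset of `S` that contains every element
independently with probability `θ`. -/
noncomputable def cubeSum (θ : ℝ) (S : Finset ι) (f : Finset ι → ℝ) (B : Finset ι) : ℝ :=
  ∑ A ∈ S.powerset, θ ^ A.card * (1 - θ) ^ (S.card - A.card) * f (B ∪ A)

theorem cubeSum_empty (θ : ℝ) (f : Finset ι → ℝ) (B : Finset ι) : cubeSum θ ∅ f B = f B := by
  simp [cubeSum]

theorem cubeSum_insert (θ : ℝ) {i : ι} {S : Finset ι} (hi : i ∉ S) (f : Finset ι → ℝ)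
    (B : Finset ι) : cubeSum θ (insert i S) f B =
      (1 - θ) * cubeSum θ S f B + θ * cubeSum θ S f (insert i B) := by
  rw [cubeSum, Finset.sum_powerset_insert hi, cubeSum, cubeSum, Finset.mul_sum, Finset.mul_sum,
    Finset.card_insert_of_notMem hi]
  congr 1
  · refine Finset.sum_congr rfl fun A hA => ?_
    have := Finset.card_le_card (Finset.mem_powerset.1 hA)
    rw [Nat.succ_sub this, pow_succ]
    ring
  · refine Finset.sum_congr rfl fun A hA => ?_
    rw [Finset.card_insert_of_notMem fun h => hi (Finset.mem_powerset.1 hA h),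
      Nat.add_sub_add_right, pow_succ, Finset.union_insert, Finset.insert_union]
    ring

theorem cubeSum_congr (θ : ℝ) {S B : Finset ι} {f g : Finset ι → ℝ}
    (h : ∀ A ⊆ S, f (B ∪ A) = g (B ∪ A)) : cubeSum θ S f B = cubeSum θ S g B :=
  Finset.sum_congr rfl fun A hA => by rw [h A (Finset.mem_powerset.1 hA)]

theorem cubeSum_mono {θ : ℝ} (h0 : 0 ≤ θ) (h1 : θ ≤ 1) {S B : Finset ι} {f g : Finset ι → ℝ}
    (h : ∀ A, f A ≤ g A) : cubeSum θ S f B ≤ cubeSum θ S g B :=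
  Finset.sum_le_sum fun A _ => by
    have := sub_nonneg.2 h1
    exact mul_le_mul_of_nonneg_left (h _) (by positivity)

theorem cubeSum_add (θ : ℝ) (S B : Finset ι) (f g : Finset ι → ℝ) :
    cubeSum θ S (fun A => f A + g A) B = cubeSum θ S f B + cubeSum θ S g B := by
  simp only [cubeSum, ← Finset.sum_add_distrib, mul_add]

theorem cubeSum_const_mul (θ : ℝ) (S B : Finset ι) (c : ℝ) (f : Finset ι → ℝ) :
    cubeSum θ S (fun A => c * f A) B = c * cubeSum θ S f B := by
  simp only [cubeSum, Finset.mul_sum]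
  exact Finset.sum_congr rfl fun A _ => by ring

theorem cubeSum_const (θ : ℝ) (S B : Finset ι) (c : ℝ) : cubeSum θ S (fun _ => c) B = c := by
  induction S using Finset.induction_on generalizing B with
  | empty => rw [cubeSum_empty]
  | insert i S hi ih => rw [cubeSum_insert θ hi, ih, ih]; ring

theorem cubeSum_nonneg {θ : ℝ} (h0 : 0 ≤ θ) (h1 : θ ≤ 1) {S B : Finset ι} {f : Finset ι → ℝ}
    (h : ∀ A, 0 ≤ f A) : 0 ≤ cubeSum θ S f B :=
  (cubeSum_const θ S B 0).symm.trans_le (cubeSum_mono h0 h1 h)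

theorem cubeSum_card (θ : ℝ) {S B : Finset ι} (h : Disjoint B S) :
    cubeSum θ S (fun A => (A.card : ℝ)) B = B.card + θ * S.card := by
  induction S using Finset.induction_on generalizing B with
  | empty => simp [cubeSum_empty]
  | insert i S hi ih =>
      rw [Finset.disjoint_insert_right] at h
      rw [cubeSum_insert θ hi, ih h.2, ih (Finset.disjoint_insert_left.2 ⟨hi, h.2⟩),
        Finset.card_insert_of_notMem h.1, Finset.card_insert_of_notMem hi]
      push_cast
      ring

theorem cubeSum_card_sub_sq (θ c : ℝ) {S B : Finset ι} (h : Disjoint B S) :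
    cubeSum θ S (fun A => ((A.card : ℝ) - c) ^ 2) B =
      S.card * (θ * (1 - θ)) + (B.card + θ * S.card - c) ^ 2 := by
  induction S using Finset.induction_on generalizing B with
  | empty => simp [cubeSum_empty]
  | insert i S hi ih =>
      rw [Finset.disjoint_insert_right] at h
      rw [cubeSum_insert θ hi, ih h.2, ih (Finset.disjoint_insert_left.2 ⟨hi, h.2⟩),
        Finset.card_insert_of_notMem h.1, Finset.card_insert_of_notMem hi]
      push_cast
      ring

end CubeSum

/-! ### Disjoint edges -/

section PairGraph

/-- The pairs `i` of the graph `pairGraph n B`. -/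
def pairIndices (n : ℕ) (B : Finset ℕ) : Finset ℕ := (Finset.range (n / 2)).filter (· ∈ B)

/-- The graph with vertices `0, …, n - 1` and the edges `{2 i, 2 i + 1}` for `i ∈ B`. -/
noncomputable def pairGraph (n : ℕ) (B : Finset ℕ) : OracleGraph n where
  m := (pairIndices n B).card
  ends e :=
    have h := Finset.mem_range.1 (Finset.mem_filter.1 ((pairIndices n B).equivFin.symm e).2).1
    s(⟨2 * ((pairIndices n B).equivFin.symm e).1, by omega⟩,
      ⟨2 * ((pairIndices n B).equivFin.symm e).1 + 1, by omega⟩)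
  adj v := if h : (v : ℕ) / 2 ∈ pairIndices n B then [(pairIndices n B).equivFin ⟨v / 2, h⟩] else []
  mem_adj v e := by
    rw [Sym2.mem_iff, Fin.ext_iff, Fin.ext_iff]
    have hs := ((pairIndices n B).equivFin.symm e).2
    split_ifs with h
    · rw [List.mem_singleton, ← Equiv.symm_apply_eq, Subtype.ext_iff]
      simp only
      omega
    · simp only [List.not_mem_nil, false_iff]
      rintro (h' | h')
      · exact h (by rw [h', Nat.mul_div_cancel_left _ two_pos]; exact hs)
      · refine h ?_
        have : (v : ℕ) / 2 = ((pairIndices n B).equivFin.symm e).1 := by omega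
        rw [this]
        exact hs
  count_le_one v e _ := by
    split_ifs
    · exact List.count_le_length
    · simp
  count_le_two v e := by
    split_ifs
    · exact List.count_le_length.trans (by simp)
    · simp

variable {n : ℕ}

theorem mem_ends_pairGraph {B : Finset ℕ} {v : Fin n} {e : Fin (pairGraph n B).m} :
    v ∈ (pairGraph n B).ends e ↔ (v : ℕ) / 2 = ((pairIndices n B).equivFin.symm e).1 := by
  change v ∈ s(_, _) ↔ _
  rw [Sym2.mem_iff, Fin.ext_iff, Fin.ext_iff]
  simp only
  omega

theorem adj_pairGraph_of_mem {B : Finset ℕ} {v : Fin n} (h : (v : ℕ) / 2 ∈ pairIndices n B) :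
    ∃ e, v ∈ (pairGraph n B).ends e ∧ (pairGraph n B).adj v = [e] := by
  have ha : (pairGraph n B).adj v = [(pairIndices n B).equivFin ⟨v / 2, h⟩] := dif_pos h
  exact ⟨_, mem_ends_pairGraph.2 (congrArg Subtype.val
    ((pairIndices n B).equivFin.symm_apply_apply ⟨v / 2, h⟩).symm), ha⟩

theorem adj_pairGraph_of_notMem {B : Finset ℕ} {v : Fin n}
    (h : (v : ℕ) / 2 ∉ pairIndices n B) : (pairGraph n B).adj v = [] := dif_neg h

theorem degree_pairGraph (B : Finset ℕ) (v : Fin n) :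
    (pairGraph n B).degree v = if (v : ℕ) / 2 ∈ pairIndices n B then 1 else 0 := by
  rw [OracleGraph.degree]
  split_ifs with h
  · obtain ⟨e, _, he⟩ := adj_pairGraph_of_mem h
    rw [he, List.length_singleton]
  · rw [adj_pairGraph_of_notMem h, List.length_nil]

theorem other_pairGraph {B : Finset ℕ} {v w : Fin n} {e : Fin (pairGraph n B).m}
    (hv : v ∈ (pairGraph n B).ends e) (hw : w ∈ (pairGraph n B).ends e) (hvw : w ≠ v) :
    (pairGraph n B).other v e = w := by
  rw [(pairGraph n B).ends_eq hv, Sym2.mem_iff] at hw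
  exact (hw.resolve_left hvw).symm

/-- Locality: an answer at `v` depends on a single bit, the presence of the pair of `v`. The
numbering of the edges does depend on all of `B`, so the answers are computed explicitly and
compared. -/
theorem neighbor_pairGraph_congr {B B' : Finset ℕ} {v : Fin n} (i : ℕ)
    (h : (v : ℕ) / 2 ∈ B ↔ (v : ℕ) / 2 ∈ B') :
    (pairGraph n B).neighbor v i = (pairGraph n B').neighbor v i := by
  have hI : (v : ℕ) / 2 ∈ pairIndices n B ↔ (v : ℕ) / 2 ∈ pairIndices n B' := by
    simp [pairIndices, h]
  by_cases hB : (v : ℕ) / 2 ∈ pairIndices n B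
  · have hB' := hI.1 hB
    obtain ⟨w, hwv, hw2⟩ : ∃ w : Fin n, w ≠ v ∧ (w : ℕ) / 2 = (v : ℕ) / 2 := by
      have hr := Finset.mem_range.1 (Finset.mem_filter.1 hB).1
      rcases Nat.even_or_odd' (v : ℕ) with ⟨k, hk | hk⟩
      · exact ⟨⟨2 * k + 1, by omega⟩, by rw [Ne, Fin.ext_iff]; simp only; omega, by simp only; omega⟩
      · exact ⟨⟨2 * k, by omega⟩, by rw [Ne, Fin.ext_iff]; simp only; omega, by simp only; omega⟩
    have key : ∀ C : Finset ℕ, (v : ℕ) / 2 ∈ pairIndices n C →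
        (pairGraph n C).neighbor v i = if i = 0 then some w else none := by
      intro C hC
      obtain ⟨e, hve, ha⟩ := adj_pairGraph_of_mem hC
      rw [OracleGraph.neighbor, ha]
      cases i with
      | zero =>
          simp only [List.getElem?_cons_zero, Option.map_some, if_true]
          congr 1
          refine other_pairGraph hve ?_ hwv
          rw [mem_ends_pairGraph] at hve ⊢
          exact hw2.trans hve
      | succ i => simp
    rw [key B hB, key B' hB']
  · have key : ∀ C : Finset ℕ, (v : ℕ) / 2 ∉ pairIndices n C →
        (pairGraph n C).neighbor v i = none := by
      intro C hC
      rw [OracleGraph.neighbor, adj_pairGraph_of_notMem hC]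
      rfl
    rw [key B hB, key B' (mt hI.2 hB)]

theorem degree_pairGraph_congr {B B' : Finset ℕ} {v : Fin n}
    (h : (v : ℕ) / 2 ∈ B ↔ (v : ℕ) / 2 ∈ B') :
    (pairGraph n B).degree v = (pairGraph n B').degree v := by
  simp [degree_pairGraph, pairIndices, h]

theorem maxDegreeLE_pairGraph (B : Finset ℕ) {Δ : ℕ} (hΔ : 1 ≤ Δ) :
    (pairGraph n B).MaxDegreeLE Δ := by
  intro v
  rw [degree_pairGraph]
  split_ifs <;> omega

theorem matchings_pairGraph (B : Finset ℕ) : (pairGraph n B).matchings = Finset.univ := by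
  classical
  rw [OracleGraph.matchings, Finset.filter_eq_self]
  refine fun M _ => ⟨fun e _ => ?_, fun e _ f _ v hv hv' => ?_⟩
  · change ¬ (s(_, _)).IsDiag
    rw [Sym2.mk_isDiag_iff, Fin.ext_iff]
    simp
  · rw [mem_ends_pairGraph] at hv hv'
    exact (pairIndices n B).equivFin.symm.injective (Subtype.ext (hv.symm.trans hv'))

/-- Every set of edges is a matching, so under the Gibbs distribution each edge is taken
independently with probability `lam / (1 + lam)`, and `cubeSum_card` gives the mean. -/
theorem expectedMatchingSize_pairGraph {B : Finset ℕ} (hB : B ⊆ Finset.range (n / 2)) {lam : ℝ}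
    (hlam : 0 < lam) :
    (pairGraph n B).expectedMatchingSize lam = lam / (1 + lam) * B.card := by
  have hm : (pairGraph n B).m = B.card := by
    change (pairIndices n B).card = _
    congr 1
    ext i
    simp only [pairIndices, Finset.mem_filter, and_iff_right_iff_imp]
    exact fun h => hB h
  have hZ : (pairGraph n B).partitionFunction lam = (1 + lam) ^ (pairGraph n B).m := by
    have := Fintype.sum_pow_mul_eq_add_pow (Fin (pairGraph n B).m) lam 1
    simp only [one_pow, mul_one, Fintype.card_fin] at this
    rw [OracleGraph.partitionFunction, matchings_pairGraph, this, add_comm]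
  have hc : cubeSum (lam / (1 + lam)) (Finset.univ : Finset (Fin (pairGraph n B).m))
      (fun A => (A.card : ℝ)) ∅ = lam / (1 + lam) * B.card := by
    rw [cubeSum_card _ (Finset.disjoint_empty_left _), Finset.card_empty, Nat.cast_zero, zero_add,
      Finset.card_univ, Fintype.card_fin, hm]
  rw [← hc, OracleGraph.expectedMatchingSize, matchings_pairGraph, cubeSum,
    Finset.powerset_univ]
  refine Finset.sum_congr rfl fun M _ => ?_
  have hM : M.card ≤ (pairGraph n B).m := by simpa using Finset.card_le_univ M
  have h1 : 1 - lam / (1 + lam) = 1 / (1 + lam) := by field_simp; ring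
  have h2 : (1 + lam) ^ (pairGraph n B).m =
      (1 + lam) ^ M.card * (1 + lam) ^ ((pairGraph n B).m - M.card) := by
    rw [← pow_add, Nat.add_sub_cancel' hM]
  rw [OracleGraph.gibbs, hZ, h1, Finset.card_univ, Fintype.card_fin, Finset.empty_union, h2,
    div_pow, div_pow, one_pow]
  field_simp

end PairGraph

/-! ### The lower bound -/

theorem sqrt_mul_add_sqrt_mul_le {x y z w : ℝ} (hx : 0 ≤ x) (hy : 0 ≤ y) (hz : 0 ≤ z)
    (hw : 0 ≤ w) : √(x * z) + √(y * w) ≤ √((x + y) * (z + w)) := by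
  apply Real.le_sqrt_of_sq_le
  rw [Real.sqrt_mul hx, Real.sqrt_mul hy]
  have e1 := Real.sq_sqrt hx
  have e2 := Real.sq_sqrt hy
  have e3 := Real.sq_sqrt hz
  have e4 := Real.sq_sqrt hw
  have : (x + y) * (z + w) = (√x ^ 2 + √y ^ 2) * (√z ^ 2 + √w ^ 2) := by rw [e1, e2, e3, e4]
  rw [this]
  nlinarith [sq_nonneg (√x * √w - √y * √z)]

/-- The affinity of the laws under biases `1 - θ` and `θ` of an event with indicator `f` is large
compared with the expectations of the cost `q`. -/
def AffinityBound (θ : ℝ) (f q : Finset ℕ → ℝ) (S B : Finset ℕ) : Prop :=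
  1 - (1 - 2 * √(θ * (1 - θ))) * √(cubeSum (1 - θ) S q B * cubeSum θ S q B) ≤
    √(cubeSum (1 - θ) S f B * cubeSum θ S f B) +
      √((1 - cubeSum (1 - θ) S f B) * (1 - cubeSum θ S f B))

theorem two_mul_sqrt_le_one (θ : ℝ) : 2 * √(θ * (1 - θ)) ≤ 1 := by
  have : √(θ * (1 - θ)) ≤ 1 / 2 := by
    rw [Real.sqrt_le_left (by norm_num)]
    nlinarith [sq_nonneg (θ - 1 / 2)]
  linarith

/-- Revealing one bit of bias `1 - θ` or `θ` costs the affinity `√(θ * (1 - θ))` per branch. The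
cost term of `AffinityBound` is a geometric mean so that this same inequality applies to it too; an
arithmetic mean would not survive the mixing of the branches. -/
theorem sqrt_convex_mul {θ x y z w : ℝ} (h0 : 0 ≤ θ) (h1 : θ ≤ 1) (hx : 0 ≤ x) (hy : 0 ≤ y)
    (hz : 0 ≤ z) (hw : 0 ≤ w) :
    √(θ * (1 - θ)) * (√(x * z) + √(y * w)) ≤
      √((θ * x + (1 - θ) * y) * ((1 - θ) * z + θ * w)) := by
  have h1' : 0 ≤ 1 - θ := by linarith
  have h := sqrt_mul_add_sqrt_mul_le (mul_nonneg h0 hx) (mul_nonneg h1' hy)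
    (mul_nonneg h1' hz) (mul_nonneg h0 hw)
  refine le_trans (le_of_eq ?_) h
  rw [mul_add, ← Real.sqrt_mul (by positivity), ← Real.sqrt_mul (by positivity)]
  congr 2 <;> ring

/-- `S` holds the bits not yet revealed and `B` those known to be present. A query of a bit in `S`
splits into two branches, with affinity `2 * √(θ * (1 - θ))` between the laws of the bit; the loss
is paid by the unit added to the cost. A query of a known bit adds cost without information. -/
theorem AffinityBound.step {θ : ℝ} (h0 : 0 ≤ θ) (h1 : θ ≤ 1) {i : ℕ}
    {f f₀ f₁ q q₀ q₁ : Finset ℕ → ℝ}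
    (hf₀ : ∀ A, f₀ A ∈ Set.Icc (0 : ℝ) 1) (hf₁ : ∀ A, f₁ A ∈ Set.Icc (0 : ℝ) 1)
    (hq₀ : ∀ A, 0 ≤ q₀ A) (hq₁ : ∀ A, 0 ≤ q₁ A)
    (hi₀ : ∀ A, i ∉ A → f A = f₀ A ∧ q A = q₀ A + 1)
    (hi₁ : ∀ A, i ∈ A → f A = f₁ A ∧ q A = q₁ A + 1)
    (H₀ : ∀ S B, Disjoint B S → AffinityBound θ f₀ q₀ S B)
    (H₁ : ∀ S B, Disjoint B S → AffinityBound θ f₁ q₁ S B)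
    (S B : Finset ℕ) (hBS : Disjoint B S) : AffinityBound θ f q S B := by
  have h1' : 0 ≤ 1 - θ := by linarith
  have h1'' : 1 - θ ≤ 1 := by linarith
  have hκ : 0 ≤ 1 - 2 * √(θ * (1 - θ)) := sub_nonneg.2 (two_mul_sqrt_le_one θ)
  have hsucc : ∀ x y : ℝ, 0 ≤ x → 0 ≤ y → 1 + √(x * y) ≤ √((x + 1) * (y + 1)) := by
    intro x y hx hy
    have := sqrt_mul_add_sqrt_mul_le hx zero_le_one hy zero_le_one
    rw [mul_one, Real.sqrt_one] at this
    linarith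
  have absent : ∀ (t : ℝ) (S B : Finset ℕ), i ∉ S → i ∉ B → cubeSum t S f B = cubeSum t S f₀ B ∧
      cubeSum t S q B = cubeSum t S q₀ B + 1 := by
    intro t S B hS hB
    have hA : ∀ A ⊆ S, i ∉ B ∪ A := fun A hA => by
      rw [Finset.mem_union, not_or]
      exact ⟨hB, fun h => hS (hA h)⟩
    refine ⟨cubeSum_congr t fun A hAS => (hi₀ _ (hA A hAS)).1, ?_⟩
    rw [cubeSum_congr t (g := fun A => q₀ A + 1) fun A hAS => (hi₀ _ (hA A hAS)).2,
      cubeSum_add t S B q₀ fun _ => 1, cubeSum_const]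
  have present : ∀ (t : ℝ) (S B : Finset ℕ), i ∈ B → cubeSum t S f B = cubeSum t S f₁ B ∧
      cubeSum t S q B = cubeSum t S q₁ B + 1 := by
    intro t S B hB
    have hA : ∀ A, i ∈ B ∪ A := fun A => Finset.mem_union_left _ hB
    refine ⟨cubeSum_congr t fun A _ => (hi₁ _ (hA A)).1, ?_⟩
    rw [cubeSum_congr t (g := fun A => q₁ A + 1) fun A _ => (hi₁ _ (hA A)).2,
      cubeSum_add t S B q₁ fun _ => 1, cubeSum_const]
  unfold AffinityBound at H₀ H₁ ⊢
  by_cases hiS : i ∈ S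
  · obtain ⟨S, hiS', rfl⟩ : ∃ T, i ∉ T ∧ S = insert i T :=
      ⟨S.erase i, Finset.notMem_erase i S, (Finset.insert_erase hiS).symm⟩
    rw [Finset.disjoint_insert_right] at hBS
    have H₀ := H₀ S B hBS.2
    have H₁ := H₁ S (insert i B) (Finset.disjoint_insert_left.2 ⟨hiS', hBS.2⟩)
    simp only [cubeSum_insert _ hiS', (absent _ S B hiS' hBS.1).1, (absent _ S B hiS' hBS.1).2,
      (present _ S (insert i B) (Finset.mem_insert_self i B)).1,
      (present _ S (insert i B) (Finset.mem_insert_self i B)).2, sub_sub_cancel]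
    have a0 := cubeSum_nonneg h1' h1'' (S := S) (B := B) fun A => (hf₀ A).1
    have a1 := cubeSum_nonneg h0 h1 (S := S) (B := B) fun A => (hf₀ A).1
    have b0 := cubeSum_nonneg h1' h1'' (S := S) (B := insert i B) fun A => (hf₁ A).1
    have b1 := cubeSum_nonneg h0 h1 (S := S) (B := insert i B) fun A => (hf₁ A).1
    have a0' := (cubeSum_mono h1' h1'' (S := S) (B := B) fun A => (hf₀ A).2).trans_eq
      (cubeSum_const _ _ _ _)
    have a1' := (cubeSum_mono h0 h1 (S := S) (B := B) fun A => (hf₀ A).2).trans_eq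
      (cubeSum_const _ _ _ _)
    have b0' := (cubeSum_mono h1' h1'' (S := S) (B := insert i B) fun A => (hf₁ A).2).trans_eq
      (cubeSum_const _ _ _ _)
    have b1' := (cubeSum_mono h0 h1 (S := S) (B := insert i B) fun A => (hf₁ A).2).trans_eq
      (cubeSum_const _ _ _ _)
    have c0 := cubeSum_nonneg h1' h1'' (S := S) (B := B) hq₀
    have c1 := cubeSum_nonneg h0 h1 (S := S) (B := B) hq₀
    have d0 := cubeSum_nonneg h1' h1'' (S := S) (B := insert i B) hq₁
    have d1 := cubeSum_nonneg h0 h1 (S := S) (B := insert i B) hq₁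
    generalize cubeSum (1 - θ) S f₀ B = u₀ at *
    generalize cubeSum θ S f₀ B = u₁ at *
    generalize cubeSum (1 - θ) S f₁ (insert i B) = v₀ at *
    generalize cubeSum θ S f₁ (insert i B) = v₁ at *
    generalize cubeSum (1 - θ) S q₀ B = x₀ at *
    generalize cubeSum θ S q₀ B = x₁ at *
    generalize cubeSum (1 - θ) S q₁ (insert i B) = y₀ at *
    generalize cubeSum θ S q₁ (insert i B) = y₁ at *
    have k1 := sqrt_convex_mul h0 h1 a0 b0 a1 b1
    have k2 := sqrt_convex_mul h0 h1 (sub_nonneg.2 a0') (sub_nonneg.2 b0') (sub_nonneg.2 a1')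
      (sub_nonneg.2 b1')
    have k3 := sqrt_convex_mul h0 h1 c0 d0 c1 d1
    have k4 := hsucc (θ * x₀ + (1 - θ) * y₀) ((1 - θ) * x₁ + θ * y₁) (by positivity)
      (by positivity)
    have e1 : θ * (x₀ + 1) + (1 - θ) * (y₀ + 1) = θ * x₀ + (1 - θ) * y₀ + 1 := by ring
    have e2 : (1 - θ) * (x₁ + 1) + θ * (y₁ + 1) = (1 - θ) * x₁ + θ * y₁ + 1 := by ring
    have e3 : 1 - (θ * u₀ + (1 - θ) * v₀) = θ * (1 - u₀) + (1 - θ) * (1 - v₀) := by ring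
    have e4 : 1 - ((1 - θ) * u₁ + θ * v₁) = (1 - θ) * (1 - u₁) + θ * (1 - v₁) := by ring
    rw [e1, e2, e3, e4]
    have hr := Real.sqrt_nonneg (θ * (1 - θ))
    set r := √(θ * (1 - θ))
    have k5 := mul_le_mul_of_nonneg_left H₀ hr
    have k6 := mul_le_mul_of_nonneg_left H₁ hr
    have k7 := mul_le_mul_of_nonneg_left (k4.trans' (add_le_add_right k3 1)) hκ
    linarith
  · by_cases hiB : i ∈ B
    · have H₁ := H₁ S B hBS
      simp only [(present _ S B hiB).1, (present _ S B hiB).2]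
      have := hsucc _ _ (cubeSum_nonneg h1' h1'' (S := S) (B := B) hq₁)
        (cubeSum_nonneg h0 h1 (S := S) (B := B) hq₁)
      nlinarith
    · have H₀ := H₀ S B hBS
      simp only [(absent _ S B hiS hiB).1, (absent _ S B hiS hiB).2]
      have := hsucc _ _ (cubeSum_nonneg h1' h1'' (S := S) (B := B) hq₀)
        (cubeSum_nonneg h0 h1 (S := S) (B := B) hq₀)
      nlinarith

open Classical in
/-- The indicator of the event that the output on `pairGraph n A` exceeds `τ`. -/
noncomputable def exceeds {n : ℕ} (P : QueryProg n ℝ) (τ : ℝ) (A : Finset ℕ) : ℝ :=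
  if τ < P.output (pairGraph n A) then 1 else 0

theorem exceeds_mem_Icc {n : ℕ} (P : QueryProg n ℝ) (τ : ℝ) (A : Finset ℕ) :
    exceeds P τ A ∈ Set.Icc (0 : ℝ) 1 := by
  rw [exceeds]
  split_ifs <;> simp

theorem affinityBound_queryProg {n : ℕ} {θ : ℝ} (h0 : 0 ≤ θ) (h1 : θ ≤ 1) (P : QueryProg n ℝ)
    (τ : ℝ) : ∀ S B : Finset ℕ, Disjoint B S →
    AffinityBound θ (exceeds P τ) (fun A => (P.queries (pairGraph n A) : ℝ)) S B := by
  induction P with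
  | ret a =>
      intro S B _
      have hf : exceeds (QueryProg.ret a : QueryProg n ℝ) τ = fun _ => if τ < a then 1 else 0 := by
        ext A
        rw [exceeds]
        rfl
      have hq : (fun A => ((QueryProg.ret a : QueryProg n ℝ).queries (pairGraph n A) : ℝ)) =
          fun _ => 0 := by
        ext A
        exact Nat.cast_zero
      rw [AffinityBound, hf, hq]
      simp only [cubeSum_const]
      split_ifs <;> simp
  | queryDegree v k ih =>
      have hd : ∀ A B : Finset ℕ, ((v : ℕ) / 2 ∈ A ↔ (v : ℕ) / 2 ∈ B) →
          exceeds (QueryProg.queryDegree v k) τ A =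
            exceeds (k ((pairGraph n B).degree v)) τ A ∧
          ((QueryProg.queryDegree v k).queries (pairGraph n A) : ℝ) =
            (k ((pairGraph n B).degree v)).queries (pairGraph n A) + 1 := by
        intro A B h
        rw [exceeds, exceeds, QueryProg.output, QueryProg.queries, degree_pairGraph_congr h]
        exact ⟨rfl, by push_cast; rfl⟩
      -- Given the bit of `v`, the answer is the one on the reference graph with edge set `∅` or `{v
      -- / 2}`, so the rest of the run is a fixed program on each branch.
      exact AffinityBound.step h0 h1 (i := (v : ℕ) / 2) (exceeds_mem_Icc _ τ) (exceeds_mem_Icc _ τ)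
        (fun _ => Nat.cast_nonneg _) (fun _ => Nat.cast_nonneg _)
        (fun A hA => hd A ∅ (by simp [hA])) (fun A hA => hd A {(v : ℕ) / 2} (by simp [hA]))
        (ih _) (ih _)
  | queryNeighbor v i k ih =>
      have hd : ∀ A B : Finset ℕ, ((v : ℕ) / 2 ∈ A ↔ (v : ℕ) / 2 ∈ B) →
          exceeds (QueryProg.queryNeighbor v i k) τ A =
            exceeds (k ((pairGraph n B).neighbor v i)) τ A ∧
          ((QueryProg.queryNeighbor v i k).queries (pairGraph n A) : ℝ) =
            (k ((pairGraph n B).neighbor v i)).queries (pairGraph n A) + 1 := by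
        intro A B h
        rw [exceeds, exceeds, QueryProg.output, QueryProg.queries, neighbor_pairGraph_congr i h]
        exact ⟨rfl, by push_cast; rfl⟩
      exact AffinityBound.step h0 h1 (i := (v : ℕ) / 2) (exceeds_mem_Icc _ τ) (exceeds_mem_Icc _ τ)
        (fun _ => Nat.cast_nonneg _) (fun _ => Nat.cast_nonneg _)
        (fun A hA => hd A ∅ (by simp [hA])) (fun A hA => hd A {(v : ℕ) / 2} (by simp [hA]))
        (ih _) (ih _)

/-- The advantage in distinguishing the two biases is bounded by the expected costs. -/
theorem AffinityBound.sub_le {δ : ℝ} (hδ0 : 0 ≤ δ) (hδ1 : δ ≤ 1) {f q : Finset ℕ → ℝ}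
    {S B : Finset ℕ} (hf : ∀ A, f A ∈ Set.Icc (0 : ℝ) 1) (hq : ∀ A, 0 ≤ q A)
    (H : AffinityBound ((1 + δ) / 2) f q S B) {α : ℝ} (hα : 0 < α) :
    cubeSum ((1 + δ) / 2) S f B - cubeSum ((1 - δ) / 2) S f B ≤
      α + δ ^ 2 / (4 * α) * (cubeSum ((1 - δ) / 2) S q B + cubeSum ((1 + δ) / 2) S q B) := by
  have h0 : 0 ≤ (1 + δ) / 2 := by linarith
  have h1 : (1 + δ) / 2 ≤ 1 := by linarith
  have h0' : 0 ≤ (1 - δ) / 2 := by linarith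
  have h1' : (1 - δ) / 2 ≤ 1 := by linarith
  have e : 1 - (1 + δ) / 2 = (1 - δ) / 2 := by ring
  rw [AffinityBound, e] at H
  have a0 := cubeSum_nonneg h0' h1' (S := S) (B := B) fun A => (hf A).1
  have a1 := cubeSum_nonneg h0 h1 (S := S) (B := B) fun A => (hf A).1
  have b0 := (cubeSum_mono h0' h1' (S := S) (B := B) fun A => (hf A).2).trans_eq
    (cubeSum_const _ _ _ _)
  have b1 := (cubeSum_mono h0 h1 (S := S) (B := B) fun A => (hf A).2).trans_eq
    (cubeSum_const _ _ _ _)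
  have c0 := cubeSum_nonneg h0' h1' (S := S) (B := B) hq
  have c1 := cubeSum_nonneg h0 h1 (S := S) (B := B) hq
  generalize cubeSum ((1 - δ) / 2) S f B = a at *
  generalize cubeSum ((1 + δ) / 2) S f B = b at *
  generalize cubeSum ((1 - δ) / 2) S q B = x at *
  generalize cubeSum ((1 + δ) / 2) S q B = y at *
  have hκ : 1 - 2 * √((1 + δ) / 2 * ((1 - δ) / 2)) ≤ δ ^ 2 := by
    have : (1 - δ ^ 2) / 2 ≤ √((1 + δ) / 2 * ((1 - δ) / 2)) := by
      apply Real.le_sqrt_of_sq_le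
      nlinarith [sq_nonneg δ, mul_nonneg hδ0 hδ0, mul_le_one₀ hδ1 hδ0 hδ1]
    linarith
  have hxy : √(x * y) ≤ (x + y) / 2 := by
    rw [Real.sqrt_le_left (by positivity)]
    nlinarith [sq_nonneg (x - y)]
  have hsq : (b - a) ^ 2 ≤ δ ^ 2 * (x + y) := by
    rw [Real.sqrt_mul a0, Real.sqrt_mul (sub_nonneg.2 b0)] at H
    have s1 := Real.sq_sqrt a0
    have s2 := Real.sq_sqrt a1
    have s3 := Real.sq_sqrt (sub_nonneg.2 b0)
    have s4 := Real.sq_sqrt (sub_nonneg.2 b1)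
    set p := √a
    set r := √b
    set p' := √(1 - a)
    set r' := √(1 - b)
    -- `(p, p')` and `(r, r')` are unit vectors in the plane: their inner product is the affinity,
    -- and `b - a` is the product of the sines of the difference and the sum of their angles.
    have haff : (b - a) ^ 2 ≤ 1 - (p * r + p' * r') ^ 2 := by
      have t1 : b - a = (r * p' - p * r') * (r * p' + p * r') := by
        have : (r * p' - p * r') * (r * p' + p * r') = r ^ 2 * p' ^ 2 - p ^ 2 * r' ^ 2 := by ring
        rw [this, s1, s2, s3, s4]
        ring
      have t2 : (r * p' - p * r') ^ 2 + (p * r + p' * r') ^ 2 = 1 := by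
        have : (r * p' - p * r') ^ 2 + (p * r + p' * r') ^ 2 =
            (p ^ 2 + p' ^ 2) * (r ^ 2 + r' ^ 2) := by ring
        rw [this, s1, s2, s3, s4]
        ring
      have t3 : (r * p' + p * r') ^ 2 ≤ 1 := by
        have : (r * p' + p * r') ^ 2 + (p * r - p' * r') ^ 2 =
            (p ^ 2 + p' ^ 2) * (r ^ 2 + r' ^ 2) := by ring
        rw [s1, s2, s3, s4] at this
        nlinarith [sq_nonneg (p * r - p' * r')]
      rw [t1, mul_pow, ← t2, add_sub_cancel_right]
      exact mul_le_of_le_one_right (sq_nonneg _) t3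
    have h2 : (1 - 2 * √((1 + δ) / 2 * ((1 - δ) / 2))) * √(x * y) ≤ δ ^ 2 * ((x + y) / 2) :=
      mul_le_mul hκ hxy (Real.sqrt_nonneg _) (sq_nonneg δ)
    nlinarith [sq_nonneg (p * r + p' * r' - 1)]
  -- Replacing the square root bound by its tangent, via `4 α (b - a) ≤ 4 α ^ 2 + (b - a) ^ 2`,
  -- makes the estimate linear in the costs, so that it can be averaged over the internal
  -- randomness.
  have e2 : α + δ ^ 2 / (4 * α) * (x + y) = (4 * α ^ 2 + δ ^ 2 * (x + y)) / (4 * α) := by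
    field_simp
  rw [e2, le_div_iff₀ (by positivity)]
  nlinarith [sq_nonneg (b - a - 2 * α)]

/-! ### Randomized algorithms: averaging over the internal randomness -/

theorem integral_cubeSum {ι Ω : Type*} [DecidableEq ι] [MeasurableSpace Ω] (P : Measure Ω) (θ : ℝ)
    (S B : Finset ι) (F : Ω → Finset ι → ℝ) (hF : ∀ A, Integrable (fun ω => F ω A) P) :
    Integrable (fun ω => cubeSum θ S (F ω) B) P ∧
      ∫ ω, cubeSum θ S (F ω) B ∂P = cubeSum θ S (fun A => ∫ ω, F ω A ∂P) B := by
  simp only [cubeSum]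
  refine ⟨integrable_finsetSum _ fun A _ => (hF _).const_mul _, ?_⟩
  rw [integral_finsetSum _ fun A _ => (hF _).const_mul _]
  simp only [integral_const_mul]

theorem RandAlgorithm.cubeSum_exceeds_sub_le {n : ℕ} (A : RandAlgorithm n) {δ : ℝ} (hδ0 : 0 ≤ δ)
    (hδ1 : δ ≤ 1) (τ : ℝ) (S : Finset ℕ) {Q : ℝ} (hQ0 : 0 ≤ Q)
    (hQ : ∀ B, A.expectedQueries (pairGraph n B) ≤ ENNReal.ofReal Q) {α : ℝ} (hα : 0 < α) :
    cubeSum ((1 + δ) / 2) S (fun B => A.P.real {ω | τ < (A.prog ω).output (pairGraph n B)}) ∅ -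
      cubeSum ((1 - δ) / 2) S (fun B => A.P.real {ω | τ < (A.prog ω).output (pairGraph n B)}) ∅ ≤
      α + δ ^ 2 / (4 * α) * (Q + Q) := by
  have hm : ∀ B, MeasurableSet {ω | τ < (A.prog ω).output (pairGraph n B)} := fun B =>
    measurableSet_lt measurable_const (A.measurable_output _)
  have he : ∀ B, (fun ω => exceeds (A.prog ω) τ B) =
      Set.indicator {ω | τ < (A.prog ω).output (pairGraph n B)} 1 := by
    intro B
    ext ω
    simp [exceeds, Set.indicator_apply]
  have hei : ∀ B, Integrable (fun ω => exceeds (A.prog ω) τ B) A.P := fun B => by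
    rw [he]
    exact (integrable_const 1).indicator (hm B)
  have heI : ∀ B, ∫ ω, exceeds (A.prog ω) τ B ∂A.P =
      A.P.real {ω | τ < (A.prog ω).output (pairGraph n B)} := fun B => by
    rw [he, integral_indicator_one (hm B)]
  have hqm : ∀ B, Measurable fun ω => ((A.prog ω).queries (pairGraph n B) : ℝ) := fun B =>
    measurable_from_nat.comp (A.measurable_queries _)
  have hql : ∀ B, ∫⁻ ω, ENNReal.ofReal ((A.prog ω).queries (pairGraph n B) : ℝ) ∂A.P ≤
      ENNReal.ofReal Q := fun B => by
    refine le_trans (le_of_eq ?_) (hQ B)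
    rw [RandAlgorithm.expectedQueries]
    simp only [ENNReal.ofReal_natCast]
  have hqi : ∀ B, Integrable (fun ω => ((A.prog ω).queries (pairGraph n B) : ℝ)) A.P := fun B =>
    ⟨(hqm B).aestronglyMeasurable, by
      rw [hasFiniteIntegral_iff_ofReal (Filter.Eventually.of_forall fun _ => Nat.cast_nonneg _)]
      exact (hql B).trans_lt ENNReal.ofReal_lt_top⟩
  have hqI : ∀ B, ∫ ω, ((A.prog ω).queries (pairGraph n B) : ℝ) ∂A.P ≤ Q := fun B => by
    rw [integral_eq_lintegral_of_nonneg_ae (Filter.Eventually.of_forall fun _ => Nat.cast_nonneg _)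
      (hqm B).aestronglyMeasurable]
    exact ENNReal.toReal_le_of_le_ofReal hQ0 (hql B)
  have f1 := integral_cubeSum A.P ((1 + δ) / 2) S ∅ (fun ω => exceeds (A.prog ω) τ) hei
  have f0 := integral_cubeSum A.P ((1 - δ) / 2) S ∅ (fun ω => exceeds (A.prog ω) τ) hei
  have q1 := integral_cubeSum A.P ((1 + δ) / 2) S ∅
    (fun ω B => ((A.prog ω).queries (pairGraph n B) : ℝ)) hqi
  have q0 := integral_cubeSum A.P ((1 - δ) / 2) S ∅
    (fun ω B => ((A.prog ω).queries (pairGraph n B) : ℝ)) hqi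
  have key : ∀ ω, _ := fun ω => AffinityBound.sub_le hδ0 hδ1 (exceeds_mem_Icc (A.prog ω) τ)
    (fun B => Nat.cast_nonneg _) (affinityBound_queryProg (by linarith) (by linarith) (A.prog ω) τ
      S ∅ (Finset.disjoint_empty_left S)) hα
  have q01 : Integrable (fun ω =>
      cubeSum ((1 - δ) / 2) S (fun B => ((A.prog ω).queries (pairGraph n B) : ℝ)) ∅ +
      cubeSum ((1 + δ) / 2) S (fun B => ((A.prog ω).queries (pairGraph n B) : ℝ)) ∅) A.P :=
    q0.1.add q1.1
  have hint := integral_mono (f1.1.sub f0.1)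
    ((integrable_const α).add (q01.const_mul (δ ^ 2 / (4 * α)))) key
  simp only [Pi.sub_apply, Pi.add_apply] at hint
  rw [integral_sub f1.1 f0.1, f1.2, f0.2,
    integral_add (integrable_const α) (q01.const_mul (δ ^ 2 / (4 * α))), integral_const_mul,
    integral_add q0.1 q1.1, q0.2, q1.2, integral_const, probReal_univ, one_smul] at hint
  simp only [heI] at hint
  refine hint.trans ?_
  have hle : ∀ θ : ℝ, 0 ≤ θ → θ ≤ 1 →
      cubeSum θ S (fun B => ∫ ω, ((A.prog ω).queries (pairGraph n B) : ℝ) ∂A.P) ∅ ≤ Q :=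
    fun θ h0 h1 => (cubeSum_mono h0 h1 hqI).trans_eq (cubeSum_const _ _ _ _)
  have g0 := hle ((1 - δ) / 2) (by linarith) (by linarith)
  have g1 := hle ((1 + δ) / 2) (by linarith) (by linarith)
  gcongr

/-- On typical inputs of either bias an approximation algorithm outputs a number on the correct
side of the threshold. -/
theorem RandAlgorithm.le_cubeSum_exceeds_sub {n : ℕ} (A : RandAlgorithm n) {Δ : ℕ} (hΔ : 1 ≤ Δ)
    {lam ε p δ t : ℝ} (hlam : 0 < lam) (hp1 : p ≤ 1) (hδ0 : 0 ≤ δ) (hδ1 : δ ≤ 1)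
    (ht : 0 < t) (hA : A.IsApproximation {G | G.MaxDegreeLE Δ}
      (fun G => G.expectedMatchingSize lam) (ε * n) p)
    (hgap : lam / (1 + lam) * (δ * (n / 2 : ℕ) / 2 - t) ≥ ε * n) :
    2 * p - 1 - (n / 2 : ℕ) / (2 * t ^ 2) ≤
      cubeSum ((1 + δ) / 2) (Finset.range (n / 2)) (fun B =>
        A.P.real {ω | lam / (1 + lam) * ((n / 2 : ℕ) / 2) < (A.prog ω).output (pairGraph n B)}) ∅ -
      cubeSum ((1 - δ) / 2) (Finset.range (n / 2)) (fun B =>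
        A.P.real {ω | lam / (1 + lam) * ((n / 2 : ℕ) / 2) < (A.prog ω).output (pairGraph n B)})
        ∅ := by
  set N := n / 2 with hN
  set S := Finset.range N with hS
  set ℓ := lam / (1 + lam) with hℓ
  have hℓ0 : 0 < ℓ := by positivity
  set τ := ℓ * ((N : ℝ) / 2) with hτ
  set u : Finset ℕ → ℝ := fun B =>
    A.P.real {ω | τ < (A.prog ω).output (pairGraph n B)} with hu
  have hE : ∀ B ⊆ S, (pairGraph n B).expectedMatchingSize lam = ℓ * B.card := fun B hB =>
    expectedMatchingSize_pairGraph hB hlam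
  have hP : ∀ B, p ≤ A.P.real {ω | |(A.prog ω).output (pairGraph n B) -
      (pairGraph n B).expectedMatchingSize lam| ≤ ε * n} := fun B =>
    (ENNReal.ofReal_le_iff_le_toReal (measure_ne_top _ _)).1
      (hA _ (maxDegreeLE_pairGraph B hΔ))
  have hmeas : ∀ B, MeasurableSet {ω | |(A.prog ω).output (pairGraph n B) -
      (pairGraph n B).expectedMatchingSize lam| ≤ ε * n} := fun B =>
    measurableSet_le (((A.measurable_output _).sub_const _).abs) measurable_const
  -- Chebyshev's inequality in pointwise form: if `B.card` deviates by `t`, the subtracted quotient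
  -- is at least `1 ≥ p` and the bound is trivial; otherwise a correct output exceeds `τ`. Only the
  -- second moment of `B.card` is needed afterwards.
  have high : ∀ B ⊆ S, p - ((B.card : ℝ) - (1 + δ) / 2 * N) ^ 2 / t ^ 2 ≤ u B := by
    intro B hB
    by_cases h : (B.card : ℝ) ≤ (1 + δ) / 2 * N - t
    · have : 1 ≤ ((B.card : ℝ) - (1 + δ) / 2 * N) ^ 2 / t ^ 2 := by
        rw [le_div_iff₀ (by positivity)]
        nlinarith
      have h0 : 0 ≤ u B := measureReal_nonneg
      linarith
    · refine (sub_le_self _ (by positivity)).trans ((hP B).trans (measureReal_mono ?_))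
      intro ω hω
      rw [Set.mem_ofPred_eq, hE B hB, abs_le] at hω
      rw [Set.mem_ofPred_eq]
      have := mul_lt_mul_of_pos_left (not_le.1 h) hℓ0
      rw [hτ]
      linarith [hω.1]
  have low : ∀ B ⊆ S, u B ≤ 1 - p + ((B.card : ℝ) - (1 - δ) / 2 * N) ^ 2 / t ^ 2 := by
    intro B hB
    by_cases h : (1 - δ) / 2 * N + t ≤ B.card
    · have : 1 ≤ ((B.card : ℝ) - (1 - δ) / 2 * N) ^ 2 / t ^ 2 := by
        rw [le_div_iff₀ (by positivity)]
        nlinarith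
      have h0 : u B ≤ 1 := measureReal_le_one
      linarith
    · refine le_trans ?_ (le_add_of_nonneg_right (by positivity))
      have h1 : u B ≤ A.P.real {ω | |(A.prog ω).output (pairGraph n B) -
          (pairGraph n B).expectedMatchingSize lam| ≤ ε * n}ᶜ := by
        refine measureReal_mono fun ω hω hω' => ?_
        rw [Set.mem_ofPred_eq] at hω
        rw [Set.mem_ofPred_eq, hE B hB, abs_le] at hω'
        have := mul_lt_mul_of_pos_left (not_le.1 h) hℓ0
        rw [hτ] at hω
        linarith [hω'.2]
      rw [probReal_compl_eq_one_sub (hmeas B)] at h1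
      linarith [hP B]
  have mono : ∀ (θ : ℝ), 0 ≤ θ → θ ≤ 1 → ∀ f g : Finset ℕ → ℝ, (∀ B ⊆ S, f B ≤ g B) →
      cubeSum θ S f ∅ ≤ cubeSum θ S g ∅ := by
    intro θ h0 h1 f g h
    refine Finset.sum_le_sum fun B hB => ?_
    have := sub_nonneg.2 h1
    rw [Finset.empty_union]
    exact mul_le_mul_of_nonneg_left (h B (Finset.mem_powerset.1 hB)) (by positivity)
  have moment : ∀ (θ a b : ℝ), cubeSum θ S (fun B => a + b * ((B.card : ℝ) - θ * N) ^ 2) ∅ =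
      a + b * (N * (θ * (1 - θ))) := by
    intro θ a b
    rw [cubeSum_add θ S ∅ (fun _ => a), cubeSum_const, cubeSum_const_mul,
      cubeSum_card_sub_sq θ _ (Finset.disjoint_empty_left S), hS, Finset.card_range,
      Finset.card_empty]
    simp
  have h1 := mono ((1 + δ) / 2) (by linarith) (by linarith)
    (fun B => p + (-1 / t ^ 2) * ((B.card : ℝ) - (1 + δ) / 2 * N) ^ 2) u fun B hB => by
      refine le_trans (le_of_eq ?_) (high B hB)
      ring
  have h2 := mono ((1 - δ) / 2) (by linarith) (by linarith) u
    (fun B => 1 - p + (1 / t ^ 2) * ((B.card : ℝ) - (1 - δ) / 2 * N) ^ 2) fun B hB => by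
      refine (low B hB).trans_eq ?_
      ring
  rw [moment] at h1 h2
  have h3 : (1 + δ) / 2 * (1 - (1 + δ) / 2) ≤ 1 / 4 := by nlinarith [sq_nonneg δ]
  have h4 : (1 - δ) / 2 * (1 - (1 - δ) / 2) ≤ 1 / 4 := by nlinarith [sq_nonneg δ]
  have h5 : 1 / t ^ 2 * (N * ((1 + δ) / 2 * (1 - (1 + δ) / 2))) ≤ 1 / t ^ 2 * (N * (1 / 4)) := by
    gcongr
  have h6 : 1 / t ^ 2 * (N * ((1 - δ) / 2 * (1 - (1 - δ) / 2))) ≤ 1 / t ^ 2 * (N * (1 / 4)) := by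
    gcongr
  have h7 : (N : ℝ) / (2 * t ^ 2) = 2 * (1 / t ^ 2 * (N * (1 / 4))) := by
    field_simp
    norm_num
  have h8 : -1 / t ^ 2 * (N * ((1 + δ) / 2 * (1 - (1 + δ) / 2))) =
      -(1 / t ^ 2 * (N * ((1 + δ) / 2 * (1 - (1 + δ) / 2)))) := by ring
  rw [h8] at h1
  rw [h7]
  linarith

theorem exists_le_expectedQueries {p : ℝ} (hp : 1 / 2 < p) (hp1 : p < 1) {lam : ℝ}
    (hlam : 0 < lam) :
    ∃ (c C ε₀ : ℝ), 0 < c ∧ 0 < C ∧ 0 < ε₀ ∧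
      ∀ (Δ : ℕ), 1 ≤ Δ → ∀ (n : ℕ), 0 < n → ∀ ε : ℝ, C / √(n : ℝ) < ε → ε ≤ ε₀ →
        ∀ A : RandAlgorithm n,
          A.IsApproximation {G | G.MaxDegreeLE Δ}
            (fun G => G.expectedMatchingSize lam) (ε * n) p →
          ∃ G : OracleGraph n, G.MaxDegreeLE Δ ∧
            ENNReal.ofReal (c / ε ^ 2) ≤ A.expectedQueries G := by
  set ℓ := lam / (1 + lam) with hℓ
  have hℓ0 : 0 < ℓ := by positivity
  have hℓ1 : ℓ ≤ 1 := by
    rw [hℓ, div_le_one (by linarith)]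
    linarith
  set g := (2 * p - 1) / 2 with hg
  have hg0 : 0 < g := by linarith
  have hg1 : g ≤ 1 / 2 := by linarith
  -- With `δ = 12 ε / ℓ`, `t = ε n / ℓ` and `α = g / 2`: the value `C = 1 / g` makes the fluctuation
  -- term at most `g / 2`, `ε₀ = ℓ / 24` gives `δ ≤ 1`, and `300 > 288` makes the query term less
  -- than `g / 2`. Too few queries would then yield `2 g - g / 2 < g / 2 + g / 2`.
  refine ⟨g ^ 2 * ℓ ^ 2 / 300, 1 / g, ℓ / 24, by positivity, by positivity, by positivity,
    fun Δ hΔ n hn ε hε hε₀ A hA => ?_⟩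
  have hn' : (0 : ℝ) < n := by exact_mod_cast hn
  have hsn : 0 < √(n : ℝ) := Real.sqrt_pos.2 hn'
  have hε0 : 0 < ε := lt_trans (by positivity) hε
  have hgε : 1 < ε ^ 2 * n * g ^ 2 := by
    rw [div_lt_iff₀ hsn, div_lt_iff₀ hg0] at hε
    have h := pow_lt_pow_left₀ hε zero_le_one two_ne_zero
    rwa [one_pow, mul_pow, mul_pow, Real.sq_sqrt hn'.le] at h
  -- The worst case of rounding is `n = 3`; `n = 1` is excluded because it contradicts `hgε`.
  have hN : (n : ℝ) / 3 ≤ (n / 2 : ℕ) := by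
    have h2 : 2 ≤ n := by
      by_contra h
      have : n = 1 := by omega
      subst this
      have h1 : ε ^ 2 ≤ 1 := pow_le_one₀ hε0.le (by linarith)
      have h2 : g ^ 2 ≤ 1 := pow_le_one₀ hg0.le (by linarith)
      have h3 := mul_le_one₀ h1 (sq_nonneg g) h2
      rw [Nat.cast_one, mul_one] at hgε
      linarith
    have : n ≤ 3 * (n / 2) := by omega
    have : (n : ℝ) ≤ 3 * (n / 2 : ℕ) := by exact_mod_cast this
    linarith
  have hN' : ((n / 2 : ℕ) : ℝ) ≤ n / 2 := Nat.cast_div_le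
  by_contra hcon
  push Not at hcon
  set Q := g ^ 2 * ℓ ^ 2 / 300 / ε ^ 2 with hQ
  have hδ1 : 12 * ε / ℓ ≤ 1 := by
    rw [div_le_one hℓ0]
    linarith
  have ht : 0 < ε * n / ℓ := by positivity
  have h1 := A.cubeSum_exceeds_sub_le (δ := 12 * ε / ℓ) (by positivity) hδ1
    (ℓ * ((n / 2 : ℕ) / 2)) (Finset.range (n / 2)) (Q := Q) (by positivity)
    (fun B => (hcon _ (maxDegreeLE_pairGraph B hΔ)).le) (half_pos hg0)
  -- The half-gap between the two means is `ℓ δ ⌊n/2⌋ / 2 = 6 ε ⌊n/2⌋ ≥ 2 ε n`: one `ε n` for the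
  -- error of the algorithm, one for the fluctuation `ℓ t`.
  have h2 := A.le_cubeSum_exceeds_sub hΔ (δ := 12 * ε / ℓ) hlam hp1.le
    (by positivity) hδ1 ht hA (by
      have e : lam / (1 + lam) * (12 * ε / ℓ * (n / 2 : ℕ) / 2 - ε * n / ℓ) =
          6 * ε * (n / 2 : ℕ) - ε * n := by
        rw [← hℓ]
        field_simp
        ring
      rw [e]
      nlinarith)
  have h3 := h2.trans h1
  have h4 : ((n / 2 : ℕ) : ℝ) / (2 * (ε * n / ℓ) ^ 2) ≤ g / 2 := by
    have e : (2 * (ε * n / ℓ) ^ 2) = 2 * (ε ^ 2 * n ^ 2) / ℓ ^ 2 := by ring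
    rw [e, div_le_iff₀ (by positivity), mul_div_assoc', le_div_iff₀ (by positivity)]
    have hl2 : ℓ ^ 2 ≤ 1 := pow_le_one₀ hℓ0.le hℓ1
    have h5 : ((n / 2 : ℕ) : ℝ) * ℓ ^ 2 ≤ n / 2 := by
      refine (mul_le_of_le_one_right (Nat.cast_nonneg _) hl2).trans hN'
    have h6 : 1 ≤ 2 * (ε ^ 2 * n * g) := by nlinarith [mul_pos (mul_pos (pow_pos hε0 2) hn') hg0]
    nlinarith
  have h7 : (12 * ε / ℓ) ^ 2 / (4 * (g / 2)) * (Q + Q) = g * (144 / 300) := by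
    rw [hQ]
    field_simp
    norm_num
  rw [h7] at h3
  linarith

theorem mainTheorem3 (p : ℝ) (hp : 1 / 2 < p) (hp1 : p < 1) :
    -- the algorithm; its constant `C` depends only on the success probability `p`
    (∃ C : ℝ, 0 < C ∧ ∀ lam : ℝ, 0 < lam →
      -- correctness on all graphs
      (∀ (n : ℕ) [NeZero n] (ε : ℝ), 0 < ε →
        (approxMatchingStatistics C lam ε n).IsApproximation Set.univ
          (fun G => G.expectedMatchingSize lam) (ε * n) p) ∧
      -- query complexity on graphs of maximum degree at most `Δ`
      (∃ (K : ℝ) (a : ℕ), 0 < K ∧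
        ∀ (Δ : ℕ), 2 ≤ Δ → ∀ ε : ℝ, 0 < ε → ε ≤ 1 / 2 →
          ∀ (n : ℕ) [NeZero n] (G : OracleGraph n), G.MaxDegreeLE Δ →
            ∀ U, ((((approxMatchingStatistics C lam ε n).prog U).queries G : ℕ) : ℝ) ≤
              K * (1 / ε) ^ (K * √(Δ : ℝ) * Real.log Δ ^ a))) ∧
    -- the lower bound, for every algorithm
    (∀ lam : ℝ, 0 < lam →
      ∃ (c C ε₀ : ℝ), 0 < c ∧ 0 < C ∧ 0 < ε₀ ∧
        ∀ (Δ : ℕ), 1 ≤ Δ → ∀ (n : ℕ), 0 < n → ∀ ε : ℝ, C / √(n : ℝ) < ε → ε ≤ ε₀ →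
          ∀ A : RandAlgorithm n,
            A.IsApproximation {G | G.MaxDegreeLE Δ}
              (fun G => G.expectedMatchingSize lam) (ε * n) p →
            ∃ G : OracleGraph n, G.MaxDegreeLE Δ ∧
              ENNReal.ofReal (c / ε ^ 2) ≤ A.expectedQueries G) := by
  have h1 : 0 < 1 - p := by linarith
  refine ⟨⟨1 / (1 - p), by positivity, fun lam hlam =>
    ⟨fun n _ ε hε => isApproximation_approxMatchingStatistics (by positivity) ?_ hlam n hε,
      exists_queries_le (by positivity) hlam⟩⟩,
    fun lam hlam => exists_le_expectedQueries hp hp1 hlam⟩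
  rw [mul_one_div, one_div_div]
  linarith
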